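/- Let $I\subset\mathbb R$ be a bounded interval of positive length, let $\langle f\rangle_J=\frac1{|J|}\int_J f$, and let $D(I)$ be the dyadic lattice rooted in $I$ (the $2^n$ subintervals of $I$ of length $2^{-n}|I|$, for $n\ge0$). For $\varepsilon\ge0$ let $\mathrm{BMO}^d_\varepsilon(I)$ be the set of real-valued $\varphi\in L^1(I)$ with $$\|\varphi\|=\Bigl(\sup_{J\in D(I)}\bigl\langle|\varphi-\langle\varphi\rangle_J|^2\bigr\rangle_J\Bigr)^{1/2}\le\varepsilon .$$ On $\Omega_\varepsilon=\{x\in\mathbb R^2: x_1^2\le x_2\le x_1^2+\varepsilon^2\}$ define the upper and lower dyadic Bellman functions, with values in $[0,+\infty]$, $$\mathbf B^{d+}_\varepsilon(x)=\sup\ \langle e^\varphi\rangle_I,\qquad \mathbf B^{d-}_\varepsilon(x)=\inf\ \langle e^\varphi\rangle_I,$$ both over all $\varphi\in\mathrm{BMO}^d_\varepsilon(I)$ with $\langle\varphi\rangle_I=x_1$ and $\langle\varphi^2\rangle_I=x_2$. For $x\in\Omega_\delta$ put $$B^+_\delta(x)=\frac{1-\sqrt{\delta^2+x_1^2-x_2}}{1-\delta}\,\exp\Bigl(x_1+\sqrt{\delta^2+x_1^2-x_2}-\delta\Bigr)\quad(0\le\delta<1),$$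 $$B^-_\delta(x)=\frac{1+\sqrt{\delta^2+x_1^2-x_2}}{1+\delta}\,\exp\Bigl(x_1-\sqrt{\delta^2+x_1^2-x_2}+\delta\Bigr)\quad(\delta\ge0).$$ Consider the equations, for $\delta\ge\varepsilon$, $$(1-\sqrt{\delta^2-\varepsilon^2})\,e^{\sqrt{\delta^2-\varepsilon^2}}\,\bigl(2-e^{\varepsilon/\sqrt2}\bigr)-(1-\delta)\,e^{\delta-\varepsilon/\sqrt2}=0,\tag{1}$$ $$(1+\sqrt{\delta^2-\varepsilon^2})\,e^{-\sqrt{\delta^2-\varepsilon^2}}\,\bigl(2-e^{-\varepsilon/\sqrt2}\bigr)-(1+\delta)\,e^{-\delta+\varepsilon/\sqrt2}=0.\tag{2}$$ **Theorem.** 1. If $0<\varepsilon<\sqrt2\log2$, then equation (1) has a unique solution $\delta=\delta^+(\varepsilon)$ in $[\varepsilon,\infty)$, it lies in $(\varepsilon,1)$, and $\mathbf B^{d+}_\varepsilon(x)=B^+_{\delta^+(\varepsilon)}(x)$ for all $x\in\Omega_\varepsilon$. If $\varepsilon=0$, then every $\delta\ge0$ solves (1), and $\mathbf B^{d+}_0(x)=B^+_\delta(x)$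 for all $x\in\Omega_0$ and every $\delta\in[0,1)$. 2. If $\varepsilon\ge\sqrt2\log2$, then for all $x\in\Omega_\varepsilon$ $$\mathbf B^{d+}_\varepsilon(x)=\begin{cases}e^{x_1}&\text{if }x_2=x_1^2,\\ +\infty&\text{if }x_2>x_1^2.\end{cases}$$ 3. If $\varepsilon>0$, then equation (2) has a unique solution $\delta=\delta^-(\varepsilon)$ in $[\varepsilon,\infty)$, it satisfies $\delta^-(\varepsilon)>\varepsilon$, and $\mathbf B^{d-}_\varepsilon(x)=B^-_{\delta^-(\varepsilon)}(x)$ for all $x\in\Omega_\varepsilon$. If $\varepsilon=0$, then every $\delta\ge0$ solves (2), and $\mathbf B^{d-}_0(x)=B^-_\delta(x)$ for all $x\in\Omega_0$ and every $\delta\ge0$. -/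

import Mathlib

open MeasureTheory
open scoped ENNReal

noncomputable section

/-- The `k`-th interval (`0 ≤ k < 2 ^ n`) of the `n`-th generation of the dyadic lattice rooted
in the interval with endpoints `a < b`. -/
def dyadicInterval (a b : ℝ) (n k : ℕ) : Set ℝ :=
  Set.Ioc (a + (k : ℝ) * ((b - a) / 2 ^ n)) (a + ((k : ℝ) + 1) * ((b - a) / 2 ^ n))

/-- The mean square oscillation `⟨|φ - ⟨φ⟩_J|²⟩_J`, as an element of `[0, ∞]`. -/
def meanSqOsc (φ : ℝ → ℝ) (J : Set ℝ) : ℝ≥0∞ :=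
  ⨍⁻ s, ENNReal.ofReal ((φ s - ⨍ t in J, φ t) ^ 2) ∂(volume.restrict J)

/-- The dyadic BMO norm (with exponent `2`) on the interval with endpoints `a < b`, as an element
of `[0, ∞]`. -/
def dyadicBMONorm (a b : ℝ) (φ : ℝ → ℝ) : ℝ≥0∞ :=
  (⨆ (n : ℕ) (k : ℕ) (_ : k < 2 ^ n), meanSqOsc φ (dyadicInterval a b n k)) ^ (1 / 2 : ℝ)

/-- The closed ball of radius `ε` about `0` in the dyadic BMO space of the interval with
endpoints `a < b`. -/
def dyadicBMOBall (a b ε : ℝ) : Set (ℝ → ℝ) :=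
  {φ | IntegrableOn φ (Set.Ioc a b) ∧ dyadicBMONorm a b φ ≤ ENNReal.ofReal ε}

/-- The domain `{x : x₁² ≤ x₂ ≤ x₁² + ε²}`. -/
def bellmanDomain (ε : ℝ) : Set (ℝ × ℝ) :=
  {x | x.1 ^ 2 ≤ x.2 ∧ x.2 ≤ x.1 ^ 2 + ε ^ 2}

/-- The functions `φ` in the `ε`-ball of dyadic BMO with `⟨φ⟩ = x₁` and `⟨φ²⟩ = x₂`. (Every `φ` in
the ball is square integrable, so both averages are genuine.) -/
def dyadicAdmissible (a b ε : ℝ) (x : ℝ × ℝ) : Set (ℝ → ℝ) :=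
  {φ | φ ∈ dyadicBMOBall a b ε ∧
    (⨍ s in Set.Ioc a b, φ s) = x.1 ∧ (⨍ s in Set.Ioc a b, φ s ^ 2) = x.2}

/-- The average `⟨e^φ⟩` over the interval with endpoints `a < b`; it is `∞` if `e^φ` is not
integrable. -/
def expAverage (a b : ℝ) (φ : ℝ → ℝ) : ℝ≥0∞ :=
  ⨍⁻ s, ENNReal.ofReal (Real.exp (φ s)) ∂(volume.restrict (Set.Ioc a b))

/-- The upper dyadic Bellman function. -/
def upperDyadicBellman (a b ε : ℝ) (x : ℝ × ℝ) : ℝ≥0∞ :=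
  ⨆ φ ∈ dyadicAdmissible a b ε x, expAverage a b φ

/-- The lower dyadic Bellman function. -/
def lowerDyadicBellman (a b ε : ℝ) (x : ℝ × ℝ) : ℝ≥0∞ :=
  ⨅ φ ∈ dyadicAdmissible a b ε x, expAverage a b φ

/-- The function `B⁺_δ`. -/
def Bplus (δ : ℝ) (x : ℝ × ℝ) : ℝ :=
  (1 - √(δ ^ 2 + x.1 ^ 2 - x.2)) / (1 - δ) * Real.exp (x.1 + √(δ ^ 2 + x.1 ^ 2 - x.2) - δ)

/-- The function `B⁻_δ`. -/
def Bminus (δ : ℝ) (x : ℝ × ℝ) : ℝ :=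
  (1 + √(δ ^ 2 + x.1 ^ 2 - x.2)) / (1 + δ) * Real.exp (x.1 - √(δ ^ 2 + x.1 ^ 2 - x.2) + δ)

/-- The equation that determines `δ⁺(ε)`. -/
def DeltaPlusEq (ε δ : ℝ) : Prop :=
  (1 - √(δ ^ 2 - ε ^ 2)) * Real.exp (√(δ ^ 2 - ε ^ 2)) * (2 - Real.exp (ε / √2))
    - (1 - δ) * Real.exp (δ - ε / √2) = 0

/-- The equation that determines `δ⁻(ε)`. -/
def DeltaMinusEq (ε δ : ℝ) : Prop :=
  (1 + √(δ ^ 2 - ε ^ 2)) * Real.exp (-√(δ ^ 2 - ε ^ 2)) * (2 - Real.exp (-(ε / √2)))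
    - (1 + δ) * Real.exp (-δ + ε / √2) = 0

end

/-! Both candidates have the form B(x) = e^{x₁} b(√(δ² + x₁² - x₂)) / b(δ) with b(ρ) = (1 -
κρ)e^{κρ}, where κ = 1 gives the upper and κ = -1 the lower one. Most of the analysis treats them
together, as statements about κB.

An admissible φ attaches to each dyadic interval J the point (⟨φ⟩_J, ⟨φ²⟩_J) of Ω_ε, and the point
of J is the midpoint of the points of its two halves. The segment joining these may leave Ω_ε, so
local concavity of κB is not enough. What is needed is the midpoint inequality for every triple in
Ω_ε (`bellmanCandidate_midpoint`), and this is what forces δ > ε. If the endpoints are not too far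
apart, it follows from the tangent plane at the midpoint. Otherwise the defect only drops when the
midpoint is pushed up to the upper boundary, and one-variable calculus remains. The critical triple
has half-distance ε/√2 between abscissae, midpoint and one endpoint on the upper boundary, the other
endpoint on the lower one. Equations (1) and (2) say that the inequality is an equality there.

Summing the midpoint inequality over the generations and passing to the limit, by Lebesgue
differentiation and Fatou, bounds ⟨e^φ⟩ by B(x) on the correct side
(`expAverage_le_bellmanCandidate`, `bellmanCandidate_le_expAverage`).

For the converse no optimal φ is exhibited. Concatenating two functions shows that the true Bellman
functions satisfy the same midpoint inequality, and adding constants shows how they scale. Applied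
to the critical triple, these facts give a linear inequality for the value at (0, ε²). With (1) or
(2) it becomes the bound by the candidate, and for e^{ε/√2} ≥ 2 it makes the upper value infinite.
Through every point of Ω_ε runs a segment between the two boundaries on which the candidate is
affine, so concavity or convexity carries the boundary bounds inside. -/

/-! ### The profile and its tangents -/

/-- The function `ρ ↦ (1 - κρ) e^{κρ}`, in terms of which both Bellman candidates are written. -/
noncomputable def bellmanProfile (κ ρ : ℝ) : ℝ := (1 - κ * ρ) * Real.exp (κ * ρ)

theorem hasDerivAt_bellmanProfile (κ ρ : ℝ) :
    HasDerivAt (bellmanProfile κ) (-(κ ^ 2 * ρ * Real.exp (κ * ρ))) ρ := by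
  have h1 : HasDerivAt (fun ρ : ℝ => κ * ρ) κ ρ := by
    simpa using (hasDerivAt_id ρ).const_mul κ
  exact ((h1.const_sub 1).mul h1.exp).congr_deriv (by ring)

theorem continuous_bellmanProfile (κ : ℝ) : Continuous (bellmanProfile κ) := by
  unfold bellmanProfile; fun_prop

theorem bellmanProfile_antitoneOn (κ : ℝ) : AntitoneOn (bellmanProfile κ) (Set.Ici 0) := by
  refine antitoneOn_of_hasDerivWithinAt_nonpos (convex_Ici 0)
    (continuous_bellmanProfile κ).continuousOn
    (fun x _ => (hasDerivAt_bellmanProfile κ x).hasDerivWithinAt) fun x hx => ?_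
  rw [interior_Ici, Set.mem_Ioi] at hx
  have : 0 ≤ κ ^ 2 * x * Real.exp (κ * x) := by positivity
  linarith

theorem bellmanProfile_monotoneOn (κ : ℝ) : MonotoneOn (bellmanProfile κ) (Set.Iic 0) := by
  refine monotoneOn_of_hasDerivWithinAt_nonneg (convex_Iic 0)
    (continuous_bellmanProfile κ).continuousOn
    (fun x _ => (hasDerivAt_bellmanProfile κ x).hasDerivWithinAt) fun x hx => ?_
  rw [interior_Iic, Set.mem_Iio] at hx
  have : 0 ≤ κ ^ 2 * (-x) * Real.exp (κ * x) := by
    have : 0 ≤ -x := by linarith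
    positivity
  linarith

theorem bellmanProfile_zero (κ : ℝ) : bellmanProfile κ 0 = 1 := by simp [bellmanProfile]

/-- The outer factor κ compensates the sign in the exponent. This is what lets one argument serve
both Bellman functions. -/
theorem monotone_mul_exp_mul (κ : ℝ) : Monotone fun x : ℝ => κ * Real.exp (κ * x) := by
  intro x y hxy
  rcases le_total 0 κ with h | h
  · exact mul_le_mul_of_nonneg_left (Real.exp_le_exp.2 (mul_le_mul_of_nonneg_left hxy h)) h
  · exact mul_le_mul_of_nonpos_left (Real.exp_le_exp.2 (mul_le_mul_of_nonpos_left hxy h)) h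

theorem hasDerivAt_bellmanProfile_tangent_sub {κ ρ₀ : ℝ} (hκ : κ ^ 2 = 1) (ρ : ℝ) :
    HasDerivAt (fun ρ => κ * (bellmanProfile κ ρ₀ + Real.exp (κ * ρ₀) / 2 * (ρ₀ ^ 2 - ρ ^ 2)
      - bellmanProfile κ ρ))
      (ρ * (κ * Real.exp (κ * ρ) - κ * Real.exp (κ * ρ₀))) ρ := by
  refine ((((((hasDerivAt_pow 2 ρ).const_sub (ρ₀ ^ 2)).const_mul
    (Real.exp (κ * ρ₀) / 2)).const_add (bellmanProfile κ ρ₀)).sub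
    (hasDerivAt_bellmanProfile κ ρ)).const_mul κ).congr_deriv ?_
  rw [hκ]; simp; ring

/-- The expression vanishes at 0 and has derivative σ(κe^{κσ} - κe^{-κσ}) ≥ 0. It is needed for
tangents with a negative parameter ρ₀. -/
theorem bellmanProfile_neg_sub {κ σ : ℝ} (hκ : κ ^ 2 = 1) (hσ : 0 ≤ σ) :
    0 ≤ κ * (bellmanProfile κ (-σ) - bellmanProfile κ σ) := by
  have hd : ∀ x : ℝ, HasDerivAt (fun σ => κ * (bellmanProfile κ (-σ) - bellmanProfile κ σ))
      (x * (κ * Real.exp (κ * x) - κ * Real.exp (κ * -x))) x := by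
    intro x
    refine ((((hasDerivAt_bellmanProfile κ (-x)).comp x (hasDerivAt_neg x)).sub
      (hasDerivAt_bellmanProfile κ x)).const_mul κ).congr_deriv ?_
    rw [hκ]; simp; ring
  have hm : MonotoneOn (fun σ => κ * (bellmanProfile κ (-σ) - bellmanProfile κ σ))
      (Set.Ici 0) := by
    refine monotoneOn_of_hasDerivWithinAt_nonneg (convex_Ici 0)
      (fun x _ => (hd x).continuousAt.continuousWithinAt)
      (fun x _ => (hd x).hasDerivWithinAt) fun x hx => ?_
    rw [interior_Ici, Set.mem_Ioi] at hx
    exact mul_nonneg hx.le (sub_nonneg.2 (monotone_mul_exp_mul κ (by linarith)))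
  simpa using hm (Set.mem_Ici.2 le_rfl) (Set.mem_Ici.2 hσ) hσ

/-- Viewed as a function of `ρ²`, `κ` times the profile lies below its tangents. -/
theorem bellmanProfile_tangent {κ ρ₀ ρ : ℝ} (hκ : κ ^ 2 = 1) (hρ : 0 ≤ ρ) (h : -ρ ≤ ρ₀) :
    0 ≤ κ * (bellmanProfile κ ρ₀ + Real.exp (κ * ρ₀) / 2 * (ρ₀ ^ 2 - ρ ^ 2)
      - bellmanProfile κ ρ) := by
  set k : ℝ → ℝ := fun ρ => κ * (bellmanProfile κ ρ₀ + Real.exp (κ * ρ₀) / 2 * (ρ₀ ^ 2 - ρ ^ 2)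
      - bellmanProfile κ ρ) with hk
  have hd := hasDerivAt_bellmanProfile_tangent_sub (ρ₀ := ρ₀) hκ
  -- Since k' has the sign of ρ - ρ₀ for ρ > 0, it suffices to compare with the value at |ρ₀|. That
  -- value is 0 if ρ₀ ≥ 0 and κ(b(ρ₀) - b(-ρ₀)) if ρ₀ < 0.
  have key : 0 ≤ k |ρ₀| := by
    rcases le_total 0 ρ₀ with h0 | h0
    · simp [hk, abs_of_nonneg h0]
    · have := bellmanProfile_neg_sub hκ (neg_nonneg.2 h0)
      simpa [hk, abs_of_nonpos h0] using this
  rcases le_or_gt |ρ₀| ρ with hle | hle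
  · have hm : MonotoneOn k (Set.Ici |ρ₀|) := by
      refine monotoneOn_of_hasDerivWithinAt_nonneg (convex_Ici _)
        (fun x _ => (hd x).continuousAt.continuousWithinAt)
        (fun x _ => (hd x).hasDerivWithinAt) fun x hx => ?_
      rw [interior_Ici, Set.mem_Ioi] at hx
      exact mul_nonneg ((abs_nonneg _).trans hx.le)
        (sub_nonneg.2 (monotone_mul_exp_mul κ ((le_abs_self _).trans hx.le)))
    exact key.trans (hm (Set.mem_Ici.2 le_rfl) (Set.mem_Ici.2 hle) hle)
  · have h0 : ρ ≤ ρ₀ := by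
      rcases abs_cases ρ₀ with ⟨h1, _⟩ | ⟨h1, _⟩ <;> linarith
    have hm : AntitoneOn k (Set.Icc 0 ρ₀) := by
      refine antitoneOn_of_hasDerivWithinAt_nonpos (convex_Icc _ _)
        (fun x _ => (hd x).continuousAt.continuousWithinAt)
        (fun x _ => (hd x).hasDerivWithinAt) fun x hx => ?_
      rw [interior_Icc] at hx
      exact mul_nonpos_of_nonneg_of_nonpos hx.1.le
        (sub_nonpos.2 (monotone_mul_exp_mul κ hx.2.le))
    rw [abs_of_nonneg (hρ.trans h0)] at key
    exact key.trans (hm ⟨hρ, h0⟩ ⟨hρ.trans h0, le_rfl⟩ h0)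

/-- The factor ρ in b'(ρ) cancels the denominator coming from the square root, so the derivative is
a pure exponential. -/
theorem hasDerivAt_bellmanProfile_sqrt {κ δ y : ℝ} (hκ : κ ^ 2 = 1) (hy : y < δ ^ 2) :
    HasDerivAt (fun y => bellmanProfile κ √(δ ^ 2 - y))
      (Real.exp (κ * √(δ ^ 2 - y)) / 2) y := by
  have hpos : 0 < δ ^ 2 - y := by linarith
  have h1 := ((hasDerivAt_id y).const_sub (δ ^ 2)).sqrt hpos.ne'
  refine ((hasDerivAt_bellmanProfile κ _).comp y h1).congr_deriv ?_
  have := Real.sqrt_pos.2 hpos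
  rw [hκ]; simp only [id]; field_simp

/-! ### The midpoint inequality in normalized coordinates -/

/-- The defect of a midpoint inequality for a Bellman candidate. Here `y` is `x₂ - x₁²`, the
endpoints have `y`-values `u` and `v`, and `t` is half of the distance of their abscissae. -/
noncomputable def midpointDefect (κ δ u v t : ℝ) : ℝ :=
  κ * (2 * bellmanProfile κ √(δ ^ 2 - ((u + v) / 2 + t ^ 2))
    - Real.exp (κ * t) * bellmanProfile κ √(δ ^ 2 - u)
    - Real.exp (-(κ * t)) * bellmanProfile κ √(δ ^ 2 - v))

/-- The tangent plane at the midpoint dominates κ times the candidate at both endpoints. In profile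
terms these are the tangents at r - t and r + t; weighted by e^{κt} and e^{-κt}, their values add up
to 2b(r). The bound on t says that r - t ≥ -p, as `bellmanProfile_tangent` requires. -/
theorem midpointDefect_nonneg_of_sqrt_le {κ δ u v t : ℝ} (hκ : κ ^ 2 = 1)
    (hu : u ≤ δ ^ 2) (hv : v ≤ δ ^ 2) (hy : (u + v) / 2 + t ^ 2 ≤ δ ^ 2) (ht : 0 ≤ t)
    (h : t ≤ √(δ ^ 2 - u) + √(δ ^ 2 - ((u + v) / 2 + t ^ 2))) :
    0 ≤ midpointDefect κ δ u v t := by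
  unfold midpointDefect
  have e1 := Real.sq_sqrt (sub_nonneg.2 hu)
  have e2 := Real.sq_sqrt (sub_nonneg.2 hv)
  have e3 := Real.sq_sqrt (sub_nonneg.2 hy)
  have n1 := Real.sqrt_nonneg (δ ^ 2 - u)
  have n2 := Real.sqrt_nonneg (δ ^ 2 - v)
  have n3 := Real.sqrt_nonneg (δ ^ 2 - ((u + v) / 2 + t ^ 2))
  generalize √(δ ^ 2 - ((u + v) / 2 + t ^ 2)) = r at *
  generalize √(δ ^ 2 - u) = p at *
  generalize √(δ ^ 2 - v) = q at *
  have t1 := bellmanProfile_tangent (ρ₀ := r - t) hκ n1 (by linarith)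
  have t2 := bellmanProfile_tangent (ρ₀ := r + t) hκ n2 (by linarith)
  have t1' := mul_nonneg (Real.exp_pos (κ * t)).le t1
  have t2' := mul_nonneg (Real.exp_pos (-(κ * t))).le t2
  have x1 : Real.exp (κ * (r - t)) = Real.exp (κ * r) * Real.exp (-(κ * t)) := by
    rw [← Real.exp_add]; ring_nf
  have x2 : Real.exp (κ * (r + t)) = Real.exp (κ * r) * Real.exp (κ * t) := by
    rw [← Real.exp_add]; ring_nf
  have x3 : Real.exp (κ * t) * Real.exp (-(κ * t)) = 1 := by
    rw [← Real.exp_add]; simp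
  have hb : bellmanProfile κ r = (1 - κ * r) * Real.exp (κ * r) := rfl
  have hb1 : bellmanProfile κ (r - t) = (1 - κ * (r - t)) * Real.exp (κ * (r - t)) := rfl
  have hb2 : bellmanProfile κ (r + t) = (1 - κ * (r + t)) * Real.exp (κ * (r + t)) := rfl
  rw [hb1, x1] at t1'
  rw [hb2, x2] at t2'
  rw [hb]
  have hsum : (r - t) ^ 2 - p ^ 2 + ((r + t) ^ 2 - q ^ 2) = 0 := by linarith
  refine (add_nonneg t1' t2').trans_eq ?_
  linear_combination (2 * κ * Real.exp (κ * r) * (1 - κ * r) +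
    κ / 2 * Real.exp (κ * r) * ((r - t) ^ 2 - p ^ 2 + ((r + t) ^ 2 - q ^ 2))) * x3 +
    κ / 2 * Real.exp (κ * r) * hsum

/-- For endpoints too far apart for the tangent argument, the defect decreases along the segment
from (u, v) to (u + A, v + B). With p, q, r the roots at the endpoints and the midpoint, the
condition p + r < t forces r ≤ q - t ≤ t + p. It persists along the way because u and the midpoint
value do not decrease. So only extreme positions need checking. -/
theorem midpointDefect_le_of_lt {κ δ u v t A B : ℝ} (hκ : κ ^ 2 = 1)
    (ht : 0 ≤ t) (hA : 0 ≤ A) (hAB : 0 ≤ A + B) (hu : u + A < δ ^ 2) (hv : v < δ ^ 2)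
    (hv' : v + B < δ ^ 2) (hy : ((u + A) + (v + B)) / 2 + t ^ 2 < δ ^ 2)
    (h : √(δ ^ 2 - u) + √(δ ^ 2 - ((u + v) / 2 + t ^ 2)) < t) :
    midpointDefect κ δ (u + A) (v + B) t ≤ midpointDefect κ δ u v t := by
  have hline : ∀ c d x : ℝ, HasDerivAt (fun x : ℝ => c + x * d) d x := fun c d x => by
    simpa using ((hasDerivAt_id x).mul_const d).const_add c
  set H : ℝ → ℝ := fun x => κ * (2 * bellmanProfile κ √(δ ^ 2 - (((u + v) / 2 + t ^ 2)
      + x * ((A + B) / 2))) - Real.exp (κ * t) * bellmanProfile κ √(δ ^ 2 - (u + x * A))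
      - Real.exp (-(κ * t)) * bellmanProfile κ √(δ ^ 2 - (v + x * B))) with hH
  have hu' : ∀ x ∈ Set.Icc (0 : ℝ) 1, u + x * A < δ ^ 2 := fun x hx => by nlinarith [hx.1, hx.2]
  have hv'' : ∀ x ∈ Set.Icc (0 : ℝ) 1, v + x * B < δ ^ 2 := fun x hx => by
    rcases le_total 0 B with hB | hB <;> nlinarith [hx.1, hx.2]
  have hy' : ∀ x ∈ Set.Icc (0 : ℝ) 1, (u + v) / 2 + t ^ 2 + x * ((A + B) / 2) < δ ^ 2 :=
    fun x hx => by nlinarith [hx.1, hx.2]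
  have hd : ∀ x ∈ Set.Icc (0 : ℝ) 1, HasDerivAt H
      (κ * (2 * (Real.exp (κ * √(δ ^ 2 - ((u + v) / 2 + t ^ 2 + x * ((A + B) / 2)))) / 2
        * ((A + B) / 2))
        - Real.exp (κ * t) * (Real.exp (κ * √(δ ^ 2 - (u + x * A))) / 2 * A)
        - Real.exp (-(κ * t)) * (Real.exp (κ * √(δ ^ 2 - (v + x * B))) / 2 * B))) x := by
    intro x hx
    exact ((((((hasDerivAt_bellmanProfile_sqrt hκ (hy' x hx)).comp x (hline _ _ x)).const_mul 2).sub
      (((hasDerivAt_bellmanProfile_sqrt hκ (hu' x hx)).comp x (hline _ _ x)).const_mul _)).sub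
      (((hasDerivAt_bellmanProfile_sqrt hκ (hv'' x hx)).comp x (hline _ _ x)).const_mul _)).const_mul
      κ)
  have hanti : AntitoneOn H (Set.Icc 0 1) := by
    refine antitoneOn_of_hasDerivWithinAt_nonpos (convex_Icc _ _)
      (fun x hx => (hd x hx).continuousAt.continuousWithinAt)
      (fun x hx => (hd x (interior_subset hx)).hasDerivWithinAt) fun x hx => ?_
    replace hx := interior_subset hx
    have e1 := Real.sq_sqrt (sub_nonneg.2 (hu' x hx).le)
    have e2 := Real.sq_sqrt (sub_nonneg.2 (hv'' x hx).le)
    have e3 := Real.sq_sqrt (sub_nonneg.2 (hy' x hx).le)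
    have n1 := Real.sqrt_nonneg (δ ^ 2 - (u + x * A))
    have n2 := Real.sqrt_nonneg (δ ^ 2 - (v + x * B))
    have n3 := Real.sqrt_nonneg (δ ^ 2 - ((u + v) / 2 + t ^ 2 + x * ((A + B) / 2)))
    have hb : √(δ ^ 2 - (u + x * A)) + √(δ ^ 2 - ((u + v) / 2 + t ^ 2 + x * ((A + B) / 2)))
        < t := by
      refine lt_of_le_of_lt (add_le_add (Real.sqrt_le_sqrt ?_) (Real.sqrt_le_sqrt ?_)) h
      · nlinarith [hx.1]
      · nlinarith [hx.1]
    generalize √(δ ^ 2 - ((u + v) / 2 + t ^ 2 + x * ((A + B) / 2))) = r at *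
    generalize √(δ ^ 2 - (u + x * A)) = p at *
    generalize √(δ ^ 2 - (v + x * B)) = q at *
    -- With this identity, r + t ≤ q amounts to p² ≤ (t - r)², and q ≤ 2t + p to r² ≤ (t + p)²; both
    -- follow from p + r < t.
    have hsum : p ^ 2 + q ^ 2 = 2 * r ^ 2 + 2 * t ^ 2 := by linarith
    have h1 : r ≤ q - t := by nlinarith
    have h2 : q - t ≤ t + p := by nlinarith
    have m1 := monotone_mul_exp_mul κ h1
    have m2 := monotone_mul_exp_mul κ h2
    simp only at m1 m2
    have x1 : Real.exp (κ * (q - t)) = Real.exp (-(κ * t)) * Real.exp (κ * q) := by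
      rw [← Real.exp_add]; ring_nf
    have x2 : Real.exp (κ * (t + p)) = Real.exp (κ * t) * Real.exp (κ * p) := by
      rw [← Real.exp_add]; ring_nf
    rw [x1] at m1 m2
    rw [x2] at m2
    linear_combination (1 / 2 * (A + B)) * m1 + (1 / 2 * A) * m2
  have := hanti (Set.left_mem_Icc.2 zero_le_one) (Set.right_mem_Icc.2 zero_le_one) zero_le_one
  have e0 : H 0 = midpointDefect κ δ u v t := by simp [hH, midpointDefect]
  have e1 : H 1 = midpointDefect κ δ (u + A) (v + B) t := by
    simp only [hH, midpointDefect]; ring_nf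
  rwa [e0, e1] at this

/-- The midpoint defect for the critical pair on the left of the extremal configuration. -/
theorem midpointDefect_top_top_nonneg {κ δ ε a t : ℝ} (hκ : κ ^ 2 = 1) (hε : ε ^ 2 < δ ^ 2)
    (ht : t ∈ Set.Icc 0 a)
    (ha : midpointDefect κ δ (ε ^ 2) (ε ^ 2 - 2 * a ^ 2) a = 0) :
    0 ≤ midpointDefect κ δ (ε ^ 2) (ε ^ 2 - 2 * t ^ 2) t := by
  set s := √(δ ^ 2 - ε ^ 2) with hs
  set R : ℝ → ℝ := fun t => √(δ ^ 2 - (ε ^ 2 - 2 * t ^ 2)) with hR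
  have hR0 : ∀ t, 0 ≤ R t := fun t => Real.sqrt_nonneg _
  have hRsq : ∀ t, R t ^ 2 = δ ^ 2 - ε ^ 2 + 2 * t ^ 2 := fun t => by
    rw [hR, Real.sq_sqrt] <;> nlinarith [sq_nonneg t]
  set F : ℝ → ℝ := fun t => midpointDefect κ δ (ε ^ 2) (ε ^ 2 - 2 * t ^ 2) t with hF
  have hFeq : ∀ t, F t = κ * (2 * bellmanProfile κ s - Real.exp (κ * t) * bellmanProfile κ s -
      Real.exp (-(κ * t)) * bellmanProfile κ (R t)) := fun t => by
    simp only [hF, midpointDefect, hs, hR]; ring_nf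
  have hF0 : F 0 = 0 := by rw [hFeq]; simp [hR, hs]; right; ring
  have hd : ∀ t, HasDerivAt F (Real.exp (κ * t) *
      (bellmanProfile κ (R t - 2 * t) - bellmanProfile κ s)) t := by
    intro t
    have hlin : HasDerivAt (fun t : ℝ => κ * t) κ t := by
      simpa using (hasDerivAt_id t).const_mul κ
    have hq : HasDerivAt (fun t : ℝ => ε ^ 2 - 2 * t ^ 2) (-(4 * t)) t :=
      (((hasDerivAt_pow 2 t).const_mul 2).const_sub (ε ^ 2)).congr_deriv (by simp; ring)
    have hlt : ε ^ 2 - 2 * t ^ 2 < δ ^ 2 := by nlinarith [sq_nonneg t]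
    have := ((((hlin.exp.mul_const (bellmanProfile κ s)).const_sub (2 * bellmanProfile κ s)).sub
      (hlin.neg.exp.mul ((hasDerivAt_bellmanProfile_sqrt hκ hlt).comp t hq))).const_mul κ)
    rw [show F = _ from funext hFeq]
    refine this.congr_deriv ?_
    have hb : bellmanProfile κ (R t) = (1 - κ * R t) * Real.exp (κ * R t) := rfl
    have hb' : bellmanProfile κ (R t - 2 * t) =
      (1 - κ * (R t - 2 * t)) * Real.exp (κ * (R t - 2 * t)) := rfl
    have x1 : Real.exp (κ * (R t - 2 * t)) =
        Real.exp (κ * R t) * Real.exp (-(κ * t)) * Real.exp (-(κ * t)) := by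
      rw [← Real.exp_add, ← Real.exp_add]; ring_nf
    have x3 : Real.exp (κ * t) * Real.exp (-(κ * t)) = 1 := by
      rw [← Real.exp_add]; simp
    simp only [Function.comp_apply, Pi.neg_apply]
    rw [show √(δ ^ 2 - (ε ^ 2 - 2 * t ^ 2)) = R t from rfl, hb, hb', x1]
    linear_combination (-(Real.exp (κ * t) * bellmanProfile κ s) +
      Real.exp (-(κ * t)) * ((1 - κ * R t) * Real.exp (κ * R t))) * hκ -
      (1 - κ * (R t - 2 * t)) * Real.exp (κ * R t) * Real.exp (-(κ * t)) * x3
  have hanti : ∀ x y, 0 ≤ x → x ≤ y → R y - 2 * y ≤ R x - 2 * x := by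
    intro x y hx hxy
    have : x ≤ R x := by
      refine abs_le_of_sq_le_sq' ?_ (hR0 x) |>.2
      nlinarith [hRsq x]
    have h2 : R y ≤ R x + 2 * (y - x) := by
      refine (abs_le_of_sq_le_sq' ?_ (by linarith [hR0 x])).2
      rw [add_sq, hRsq, hRsq]
      nlinarith [mul_nonneg (sub_nonneg.2 hxy) (sub_nonneg.2 this)]
    linarith
  have hs0 : R 0 - 2 * 0 = s := by simp [hR, hs]
  have hsnn : 0 ≤ s := Real.sqrt_nonneg _
  -- As t grows, R t - 2t decreases from s, and b increases on the negative and decreases on the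
  -- positive half-line. So F' changes sign at most once, from plus to minus, and F is bounded below
  -- by its end values F 0 = F a = 0.
  rcases le_or_gt (bellmanProfile κ s) (bellmanProfile κ (R t - 2 * t)) with hc | hc
  · have hm : MonotoneOn F (Set.Icc 0 t) := by
      refine monotoneOn_of_hasDerivWithinAt_nonneg (convex_Icc _ _)
        (fun x _ => (hd x).continuousAt.continuousWithinAt)
        (fun x _ => (hd x).hasDerivWithinAt) fun x hx => ?_
      replace hx := interior_subset hx
      refine mul_nonneg (Real.exp_pos _).le (sub_nonneg.2 ?_)
      rcases le_total 0 (R x - 2 * x) with h | h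
      · exact bellmanProfile_antitoneOn κ (Set.mem_Ici.2 h) (Set.mem_Ici.2 hsnn)
          (hs0 ▸ hanti 0 x le_rfl hx.1)
      · have := hanti x t hx.1 hx.2
        exact hc.trans (bellmanProfile_monotoneOn κ (Set.mem_Iic.2 (this.trans h))
          (Set.mem_Iic.2 h) this)
    simpa [hF0] using hm (Set.left_mem_Icc.2 ht.1) (Set.right_mem_Icc.2 ht.1) ht.1
  · have hneg : R t - 2 * t ≤ 0 := by
      by_contra! h
      exact absurd (bellmanProfile_antitoneOn κ (Set.mem_Ici.2 h.le) (Set.mem_Ici.2 hsnn)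
          (hs0 ▸ hanti 0 t le_rfl ht.1)) (not_le.2 hc)
    have hm : AntitoneOn F (Set.Icc t a) := by
      refine antitoneOn_of_hasDerivWithinAt_nonpos (convex_Icc _ _)
        (fun x _ => (hd x).continuousAt.continuousWithinAt)
        (fun x _ => (hd x).hasDerivWithinAt) fun x hx => ?_
      replace hx := interior_subset hx
      refine mul_nonpos_of_nonneg_of_nonpos (Real.exp_pos _).le (sub_nonpos.2 ?_)
      have := hanti t x ht.1 hx.1
      exact (bellmanProfile_monotoneOn κ (Set.mem_Iic.2 (this.trans hneg))
          (Set.mem_Iic.2 hneg) this).trans hc.le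
    have := hm (Set.left_mem_Icc.2 ht.2) (Set.right_mem_Icc.2 ht.2) ht.2
    rwa [show F a = 0 from ha] at this

/-- The midpoint defect for the critical pair on the right of the extremal configuration. -/
theorem midpointDefect_bottom_nonneg {κ δ ε a t : ℝ} (hκ : κ ^ 2 = 1) (hδ : 0 ≤ δ)
    (hε : ε ^ 2 < δ ^ 2) (ha0 : 0 ≤ a) (ha2 : 2 * a ^ 2 = ε ^ 2) (ht : a ≤ t)
    (ha : midpointDefect κ δ (ε ^ 2) (ε ^ 2 - 2 * a ^ 2) a = 0) :
    0 ≤ midpointDefect κ δ (2 * ε ^ 2 - 2 * t ^ 2) 0 t := by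
  set s := √(δ ^ 2 - ε ^ 2) with hs
  set R : ℝ → ℝ := fun t => √(δ ^ 2 - (2 * ε ^ 2 - 2 * t ^ 2)) with hR
  set F : ℝ → ℝ := fun t => midpointDefect κ δ (2 * ε ^ 2 - 2 * t ^ 2) 0 t with hF
  have hFeq : ∀ t, F t = κ * (2 * bellmanProfile κ s - Real.exp (κ * t) * bellmanProfile κ (R t) -
      Real.exp (-(κ * t)) * bellmanProfile κ δ) := fun t => by
    simp only [hF, midpointDefect, hs, hR, sub_zero, Real.sqrt_sq hδ]; ring_nf
  have hFa : F a = 0 := by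
    rw [← ha]; simp only [hF]; congr 1 <;> linarith
  have hlt : ∀ t, a ≤ t → 2 * ε ^ 2 - 2 * t ^ 2 < δ ^ 2 := fun t ht => by nlinarith
  have hd : ∀ t, a ≤ t → HasDerivAt F (Real.exp (-(κ * t)) *
      (bellmanProfile κ δ - bellmanProfile κ (2 * t + R t))) t := by
    intro t ht
    have hlin : HasDerivAt (fun t : ℝ => κ * t) κ t := by
      simpa using (hasDerivAt_id t).const_mul κ
    have hq : HasDerivAt (fun t : ℝ => 2 * ε ^ 2 - 2 * t ^ 2) (-(4 * t)) t :=
      (((hasDerivAt_pow 2 t).const_mul 2).const_sub (2 * ε ^ 2)).congr_deriv (by simp; ring)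
    have := ((((hlin.exp.mul ((hasDerivAt_bellmanProfile_sqrt hκ (hlt t ht)).comp t hq)).const_sub
      (2 * bellmanProfile κ s)).sub
      (hlin.neg.exp.mul_const (bellmanProfile κ δ))).const_mul κ)
    rw [show F = _ from funext hFeq]
    refine this.congr_deriv ?_
    have hb : bellmanProfile κ (R t) = (1 - κ * R t) * Real.exp (κ * R t) := rfl
    have hb' : bellmanProfile κ (2 * t + R t) =
      (1 - κ * (2 * t + R t)) * Real.exp (κ * (2 * t + R t)) := rfl
    have x1 : Real.exp (κ * (2 * t + R t)) =
        Real.exp (κ * R t) * Real.exp (κ * t) * Real.exp (κ * t) := by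
      rw [← Real.exp_add, ← Real.exp_add]; ring_nf
    have x3 : Real.exp (κ * t) * Real.exp (-(κ * t)) = 1 := by
      rw [← Real.exp_add]; simp
    simp only [Function.comp_apply, Pi.neg_apply]
    rw [show √(δ ^ 2 - (2 * ε ^ 2 - 2 * t ^ 2)) = R t from rfl, hb, hb', x1]
    linear_combination (Real.exp (-(κ * t)) * bellmanProfile κ δ -
      Real.exp (κ * t) * ((1 - κ * R t) * Real.exp (κ * R t))) * hκ +
      (1 - κ * (2 * t + R t)) * Real.exp (κ * R t) * Real.exp (κ * t) * x3
  have hm : MonotoneOn F (Set.Ici a) := by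
    refine monotoneOn_of_hasDerivWithinAt_nonneg (convex_Ici _)
      (fun x hx => (hd x hx).continuousAt.continuousWithinAt)
      (fun x hx => (hd x (interior_subset hx)).hasDerivWithinAt) fun x hx => ?_
    replace hx : a ≤ x := interior_subset hx
    refine mul_nonneg (Real.exp_pos _).le (sub_nonneg.2 ?_)
    have hR0 : 0 ≤ R x := Real.sqrt_nonneg _
    have hRsq : R x ^ 2 = δ ^ 2 - (2 * ε ^ 2 - 2 * x ^ 2) :=
      Real.sq_sqrt (sub_nonneg.2 (hlt x hx).le)
    -- As b decreases on the positive half-line, this makes F' nonnegative beyond a, where F starts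
    -- from 0.
    have hle : δ ≤ 2 * x + R x := by
      refine (abs_le_of_sq_le_sq' ?_ (by linarith)).2
      nlinarith [mul_nonneg (ha0.trans hx) hR0]
    exact bellmanProfile_antitoneOn κ (Set.mem_Ici.2 hδ) (Set.mem_Ici.2 (hδ.trans hle)) hle
  simpa [hFa] using hm (Set.mem_Ici.2 le_rfl) (Set.mem_Ici.2 ht) ht

/-- Either the tangent argument applies, or the midpoint is pushed to the upper boundary with t
fixed. For t ≤ ε/√2 the first endpoint is moved to the upper boundary as well; for t ≥ ε/√2 the
second is moved to the lower boundary. The two families meet at t = ε/√2, where the defect vanishes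
by the equation for δ. -/
theorem midpointDefect_nonneg {κ δ ε u v t : ℝ} (hκ : κ ^ 2 = 1) (hε : 0 < ε) (hδ : ε < δ)
    (heq : bellmanProfile κ √(δ ^ 2 - ε ^ 2) * (2 - Real.exp (κ * (ε / √2))) =
      bellmanProfile κ δ * Real.exp (-(κ * (ε / √2))))
    (hu : u ∈ Set.Icc 0 (ε ^ 2)) (hv : v ∈ Set.Icc 0 (ε ^ 2)) (ht : 0 ≤ t)
    (hy : (u + v) / 2 + t ^ 2 ≤ ε ^ 2) : 0 ≤ midpointDefect κ δ u v t := by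
  have hlt : ε ^ 2 < δ ^ 2 := by nlinarith
  have hδ0 : 0 ≤ δ := by linarith
  set a := ε / √2 with ha
  have ha0 : 0 ≤ a := by positivity
  have ha2 : 2 * a ^ 2 = ε ^ 2 := by
    rw [ha, div_pow, Real.sq_sqrt (by norm_num)]; ring
  have hzero : midpointDefect κ δ (ε ^ 2) (ε ^ 2 - 2 * a ^ 2) a = 0 := by
    unfold midpointDefect
    rw [show (ε ^ 2 + (ε ^ 2 - 2 * a ^ 2)) / 2 + a ^ 2 = ε ^ 2 by ring, ha2, sub_self, sub_zero,
      Real.sqrt_sq hδ0]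
    linear_combination κ * heq
  by_cases h : t ≤ √(δ ^ 2 - u) + √(δ ^ 2 - ((u + v) / 2 + t ^ 2))
  · exact midpointDefect_nonneg_of_sqrt_le hκ (hu.2.trans hlt.le) (hv.2.trans hlt.le)
      (hy.trans hlt.le) ht h
  push Not at h
  rcases le_total t a with hta | hta
  · have h1 := midpointDefect_top_top_nonneg hκ hlt ⟨ht, hta⟩ hzero
    -- The target values ε² and ε² - 2t² put the midpoint at height exactly ε².
    have h2 := midpointDefect_le_of_lt (A := ε ^ 2 - u) (B := ε ^ 2 - 2 * t ^ 2 - v) hκ ht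
      (by linarith [hu.2]) (by linarith) (by linarith) (by linarith [hv.2])
      (by nlinarith) (by nlinarith) h
    simp only [add_sub_cancel] at h2
    exact h1.trans h2
  · have h1 := midpointDefect_bottom_nonneg hκ hδ0 hlt ha0 ha2 hta hzero
    -- Here B = -v may be negative; only A ≥ 0 and A + B ≥ 0 matter, and both follow from the height
    -- of the midpoint.
    have h2 := midpointDefect_le_of_lt (A := 2 * ε ^ 2 - 2 * t ^ 2 - u) (B := 0 - v) hκ ht
      (by linarith [hv.1]) (by linarith) (by nlinarith) (by linarith [hv.2])
      (by nlinarith) (by nlinarith) h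
    simp only [add_sub_cancel] at h2
    exact h1.trans h2

/-! ### The candidates on the domain -/

/-- The common form of the candidates `Bplus` (`κ = 1`) and `Bminus` (`κ = -1`). -/
noncomputable def bellmanCandidate (κ δ : ℝ) (x : ℝ × ℝ) : ℝ :=
  Real.exp x.1 * bellmanProfile κ √(δ ^ 2 + x.1 ^ 2 - x.2) / bellmanProfile κ δ

theorem Bplus_eq_bellmanCandidate (δ : ℝ) (x : ℝ × ℝ) :
    Bplus δ x = bellmanCandidate 1 δ x := by
  unfold Bplus bellmanCandidate bellmanProfile
  rw [Real.exp_sub, Real.exp_add, one_mul, one_mul, div_mul_div_comm]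
  ring

theorem Bminus_eq_bellmanCandidate (δ : ℝ) (x : ℝ × ℝ) :
    Bminus δ x = bellmanCandidate (-1) δ x := by
  unfold Bminus bellmanCandidate bellmanProfile
  rw [Real.exp_add, Real.exp_sub, neg_one_mul, neg_one_mul, Real.exp_neg, Real.exp_neg,
    sub_neg_eq_add, sub_neg_eq_add]
  field_simp

theorem bellmanCandidate_midpoint {κ δ ε : ℝ} (hκ : κ ^ 2 = 1) (hε : 0 < ε) (hδ : ε < δ)
    (hpos : 0 < bellmanProfile κ δ)
    (heq : bellmanProfile κ √(δ ^ 2 - ε ^ 2) * (2 - Real.exp (κ * (ε / √2))) =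
      bellmanProfile κ δ * Real.exp (-(κ * (ε / √2))))
    {x y z : ℝ × ℝ} (hx : x ∈ bellmanDomain ε) (hy : y ∈ bellmanDomain ε)
    (hz : z ∈ bellmanDomain ε) (h1 : x.1 = (y.1 + z.1) / 2) (h2 : x.2 = (y.2 + z.2) / 2) :
    0 ≤ κ * (2 * bellmanCandidate κ δ x - bellmanCandidate κ δ y - bellmanCandidate κ δ z) := by
  -- The defect is not symmetric in its endpoints for t ≥ 0: the first is the right one for κ = 1
  -- and the left one for κ = -1.
  wlog h : 0 ≤ κ * (y.1 - z.1) generalizing y z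
  · have := this hz hy (by rw [h1, add_comm]) (by rw [h2, add_comm]) (by nlinarith)
    linarith
  set t := κ * (y.1 - z.1) / 2 with ht
  have e1 : y.1 = x.1 + κ * t := by rw [ht, h1]; linear_combination (y.1 - z.1) / 2 * (-hκ)
  have e2 : z.1 = x.1 + -(κ * t) := by rw [ht, h1]; linear_combination (y.1 - z.1) / 2 * hκ
  have ht2 : t ^ 2 = ((y.1 - z.1) / 2) ^ 2 := by
    rw [ht]; linear_combination ((y.1 - z.1) / 2) ^ 2 * hκ
  have hyx : (y.2 - y.1 ^ 2 + (z.2 - z.1 ^ 2)) / 2 + t ^ 2 = x.2 - x.1 ^ 2 := by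
    rw [ht2, h1, h2]; ring
  have key := midpointDefect_nonneg (u := y.2 - y.1 ^ 2) (v := z.2 - z.1 ^ 2) (t := t) hκ hε hδ heq
    ⟨by linarith [hy.1], by linarith [hy.2]⟩ ⟨by linarith [hz.1], by linarith [hz.2]⟩
    (by rw [ht]; linarith) (by rw [hyx]; linarith [hx.2])
  unfold midpointDefect at key
  rw [hyx] at key
  have aux : ∀ w : ℝ × ℝ, √(δ ^ 2 + w.1 ^ 2 - w.2) = √(δ ^ 2 - (w.2 - w.1 ^ 2)) := fun w => by
    congr 1; ring
  have : κ * (2 * bellmanCandidate κ δ x - bellmanCandidate κ δ y - bellmanCandidate κ δ z) =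
      Real.exp x.1 / bellmanProfile κ δ * (κ * (2 * bellmanProfile κ √(δ ^ 2 - (x.2 - x.1 ^ 2))
    - Real.exp (κ * t) * bellmanProfile κ √(δ ^ 2 - (y.2 - y.1 ^ 2))
    - Real.exp (-(κ * t)) * bellmanProfile κ √(δ ^ 2 - (z.2 - z.1 ^ 2)))) := by
    unfold bellmanCandidate
    rw [aux x, aux y, aux z, show Real.exp y.1 = Real.exp x.1 * Real.exp (κ * t) by
      rw [← Real.exp_add, e1], show Real.exp z.1 = Real.exp x.1 * Real.exp (-(κ * t)) by
      rw [← Real.exp_add, e2]]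
    ring
  rw [this]
  positivity

theorem sqrt_sub_le_of_mem_bellmanDomain {δ ε : ℝ} {x : ℝ × ℝ} (hδ : 0 ≤ δ)
    (hx : x ∈ bellmanDomain ε) : √(δ ^ 2 + x.1 ^ 2 - x.2) ≤ δ := by
  rw [Real.sqrt_le_left hδ]
  linarith [hx.1]

theorem exp_le_bellmanCandidate {κ δ ε : ℝ} {x : ℝ × ℝ} (hδ : 0 ≤ δ)
    (hpos : 0 < bellmanProfile κ δ) (hx : x ∈ bellmanDomain ε) :
    Real.exp x.1 ≤ bellmanCandidate κ δ x := by
  unfold bellmanCandidate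
  rw [le_div_iff₀ hpos]
  exact mul_le_mul_of_nonneg_left (bellmanProfile_antitoneOn κ (Set.mem_Ici.2 (Real.sqrt_nonneg _))
    (Set.mem_Ici.2 hδ) (sqrt_sub_le_of_mem_bellmanDomain hδ hx)) (Real.exp_pos _).le

theorem bellmanCandidate_le {κ δ : ℝ} {x : ℝ × ℝ} (hpos : 0 < bellmanProfile κ δ) :
    bellmanCandidate κ δ x ≤ (bellmanProfile κ δ)⁻¹ * Real.exp x.1 := by
  unfold bellmanCandidate
  rw [div_eq_inv_mul]
  have : bellmanProfile κ √(δ ^ 2 + x.1 ^ 2 - x.2) ≤ 1 := by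
    rw [← bellmanProfile_zero κ]
    exact bellmanProfile_antitoneOn κ (Set.mem_Ici.2 le_rfl) (Set.mem_Ici.2 (Real.sqrt_nonneg _))
      (Real.sqrt_nonneg _)
  have h2 := (Real.exp_pos x.1)
  gcongr
  nlinarith

theorem bellmanCandidate_of_eq_sq {κ δ : ℝ} {x : ℝ × ℝ} (hδ : 0 ≤ δ)
    (hpos : 0 < bellmanProfile κ δ) (hx : x.2 = x.1 ^ 2) :
    bellmanCandidate κ δ x = Real.exp x.1 := by
  unfold bellmanCandidate
  rw [hx, add_sub_cancel_right, Real.sqrt_sq hδ, mul_div_assoc, div_self hpos.ne', mul_one]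

theorem continuous_bellmanCandidate (κ δ : ℝ) : Continuous (bellmanCandidate κ δ) := by
  unfold bellmanCandidate bellmanProfile; fun_prop

/-! ### The equations for δ -/

theorem deltaPlusEq_iff (ε δ : ℝ) : DeltaPlusEq ε δ ↔
    bellmanProfile 1 √(δ ^ 2 - ε ^ 2) * (2 - Real.exp (1 * (ε / √2))) =
      bellmanProfile 1 δ * Real.exp (-(1 * (ε / √2))) := by
  unfold DeltaPlusEq bellmanProfile
  rw [sub_eq_zero, sub_eq_add_neg δ, Real.exp_add]
  simp only [one_mul, mul_assoc]

theorem deltaMinusEq_iff (ε δ : ℝ) : DeltaMinusEq ε δ ↔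
    bellmanProfile (-1) √(δ ^ 2 - ε ^ 2) * (2 - Real.exp (-1 * (ε / √2))) =
      bellmanProfile (-1) δ * Real.exp (-(-1 * (ε / √2))) := by
  unfold DeltaMinusEq bellmanProfile
  rw [sub_eq_zero, Real.exp_add]
  simp only [neg_one_mul, mul_assoc, sub_neg_eq_add, neg_neg]

theorem deltaPlusEq_zero {δ : ℝ} (hδ : 0 ≤ δ) : DeltaPlusEq 0 δ := by
  simp [DeltaPlusEq, Real.sqrt_sq hδ]; ring

theorem deltaMinusEq_zero {δ : ℝ} (hδ : 0 ≤ δ) : DeltaMinusEq 0 δ := by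
  simp [DeltaMinusEq, Real.sqrt_sq hδ]; ring

/-- The derivative is a positive multiple of e^y - y - 1 with y = (2 - √2)x. The value at 0 is 2, so
comparison with x = ε/√2 and x = -ε/√2 decides the signs at δ = ε in equations (1) and (2),
respectively. -/
theorem strictMono_one_sub_mul_exp_add_exp :
    StrictMono fun x : ℝ => (1 - √2 * x) * Real.exp ((√2 - 1) * x) + Real.exp x := by
  have h2 : √2 ^ 2 = 2 := Real.sq_sqrt (by norm_num)
  have h2' : √2 < 2 := by nlinarith [Real.sqrt_nonneg 2]
  have hd : ∀ x : ℝ, HasDerivAt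
      (fun x : ℝ => (1 - √2 * x) * Real.exp ((√2 - 1) * x) + Real.exp x)
      (Real.exp ((√2 - 1) * x) * (Real.exp ((2 - √2) * x) - ((2 - √2) * x + 1))) x := by
    intro x
    have l1 : HasDerivAt (fun x : ℝ => √2 * x) √2 x := by
      simpa using (hasDerivAt_id x).const_mul √2
    have l2 : HasDerivAt (fun x : ℝ => (√2 - 1) * x) (√2 - 1) x := by
      simpa using (hasDerivAt_id x).const_mul (√2 - 1)
    refine (((l1.const_sub 1).mul l2.exp).add (Real.hasDerivAt_exp x)).congr_deriv ?_
    have : Real.exp x = Real.exp ((√2 - 1) * x) * Real.exp ((2 - √2) * x) := by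
      rw [← Real.exp_add]; ring_nf
    rw [this]
    linear_combination -(x * Real.exp ((√2 - 1) * x)) * h2
  have hpos : ∀ x : ℝ, x ≠ 0 →
      0 < Real.exp ((√2 - 1) * x) * (Real.exp ((2 - √2) * x) - ((2 - √2) * x + 1)) := by
    intro x hx
    refine mul_pos (Real.exp_pos _) (sub_pos.2 (Real.add_one_lt_exp ?_))
    exact mul_ne_zero (by linarith) hx
  have hc : Continuous fun x : ℝ => (1 - √2 * x) * Real.exp ((√2 - 1) * x) + Real.exp x := by
    fun_prop
  refine StrictMonoOn.Iic_union_Ici (a := 0) ?_ ?_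
  · refine strictMonoOn_of_hasDerivWithinAt_pos (convex_Iic _) hc.continuousOn
      (fun x _ => (hd x).hasDerivWithinAt) fun x hx => hpos x ?_
    rw [interior_Iic] at hx; exact hx.ne
  · refine strictMonoOn_of_hasDerivWithinAt_pos (convex_Ici _) hc.continuousOn
      (fun x _ => (hd x).hasDerivWithinAt) fun x hx => hpos x ?_
    rw [interior_Ici] at hx; exact hx.ne'

theorem sqrt_two_mul_log_two_lt_one : √2 * Real.log 2 < 1 := by
  have h1 : √2 < 1.42 := by rw [Real.sqrt_lt' (by norm_num)]; norm_num
  nlinarith [Real.log_two_lt_d9, Real.log_two_gt_d9]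

theorem hasDerivAt_sqrt_sq_sub_sq {δ ε : ℝ} (h : ε ^ 2 < δ ^ 2) :
    HasDerivAt (fun δ : ℝ => √(δ ^ 2 - ε ^ 2)) (δ / √(δ ^ 2 - ε ^ 2)) δ := by
  refine (((hasDerivAt_pow 2 δ).sub_const (ε ^ 2)).sqrt (sub_pos.2 h).ne').congr_deriv ?_
  simp; ring

/-- The left side of (1), times e^{-ε/√2} in its second term as in H, is strictly increasing in δ,
negative at ε and positive at 1. Positivity at 1, where the second term vanishes, is where e^{ε/√2}
< 2 enters. -/
theorem exists_deltaPlus {ε : ℝ} (hε : 0 < ε) (hε' : ε < √2 * Real.log 2) :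
    ∃ δ, ε < δ ∧ δ < 1 ∧ ∀ δ', ε ≤ δ' → (DeltaPlusEq ε δ' ↔ δ' = δ) := by
  have h2 : √2 ^ 2 = 2 := Real.sq_sqrt (by norm_num)
  set a := ε / √2 with ha
  have ha0 : 0 < a := by positivity
  have haε : ε = √2 * a := by rw [ha]; field_simp
  have hε1 : ε < 1 := hε'.trans sqrt_two_mul_log_two_lt_one
  have hea : Real.exp a < 2 := by
    rw [← Real.lt_log_iff_exp_lt (by norm_num), ha, div_lt_iff₀ (by positivity), mul_comm]
    exact hε'
  set H : ℝ → ℝ := fun δ => bellmanProfile 1 √(δ ^ 2 - ε ^ 2) * (2 - Real.exp a) -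
    bellmanProfile 1 δ * Real.exp (-a) with hH
  have hiff : ∀ δ, DeltaPlusEq ε δ ↔ H δ = 0 := fun δ => by
    rw [deltaPlusEq_iff, hH, sub_eq_zero, one_mul]
  have hc : Continuous H := by simp only [hH, bellmanProfile]; fun_prop
  have hmono : StrictMonoOn H (Set.Ici ε) := by
    refine strictMonoOn_of_hasDerivWithinAt_pos (convex_Ici _) hc.continuousOn
      (f' := fun δ => δ * Real.exp (-a) * (Real.exp δ - Real.exp √(δ ^ 2 - ε ^ 2) *
        (2 * Real.exp a - Real.exp a ^ 2))) (fun δ hδ => HasDerivAt.hasDerivWithinAt ?_)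
      fun δ hδ => ?_
    · rw [interior_Ici, Set.mem_Ioi] at hδ
      have hlt : ε ^ 2 < δ ^ 2 := by nlinarith
      have hs := Real.sqrt_pos.2 (sub_pos.2 hlt)
      refine ((((hasDerivAt_bellmanProfile 1 _).comp δ (hasDerivAt_sqrt_sq_sub_sq hlt)).mul_const
        (2 - Real.exp a)).sub ((hasDerivAt_bellmanProfile 1 δ).mul_const
          (Real.exp (-a)))).congr_deriv ?_
      rw [Real.exp_neg]
      field_simp
      ring
    · rw [interior_Ici, Set.mem_Ioi] at hδ
      have hs : √(δ ^ 2 - ε ^ 2) < δ := by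
        rw [Real.sqrt_lt' (by linarith)]; nlinarith
      have h1 := Real.exp_lt_exp.2 hs
      have : 0 < δ := by linarith
      have h3 := Real.exp_pos √(δ ^ 2 - ε ^ 2)
      refine mul_pos (by positivity) (sub_pos.2 (lt_of_le_of_lt ?_ h1))
      -- The factor 2e^a - e^{2a} equals 1 - (e^a - 1)², hence is at most 1.
      nlinarith [sq_nonneg (Real.exp a - 1)]
  have hneg : H ε < 0 := by
    have h := strictMono_one_sub_mul_exp_add_exp ha0
    simp only [mul_zero, sub_zero, Real.exp_zero, mul_one] at h
    have h3 : bellmanProfile 1 ε * Real.exp (-a) = (1 - √2 * a) * Real.exp ((√2 - 1) * a) := by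
      rw [bellmanProfile, mul_assoc, ← Real.exp_add,
        show 1 * ε + -a = (√2 - 1) * a by rw [haε]; ring, one_mul, ← haε]
    simp only [hH, sub_self, Real.sqrt_zero, bellmanProfile_zero, one_mul, h3]
    linarith
  have hone : 0 < H 1 := by
    have hs : √(1 ^ 2 - ε ^ 2) < 1 := by
      rw [Real.sqrt_lt' one_pos]; nlinarith
    simp only [hH, bellmanProfile, one_mul, sub_self, zero_mul, sub_zero]
    exact mul_pos (mul_pos (by linarith) (Real.exp_pos _)) (by linarith)
  obtain ⟨δ, hδ, hδ0⟩ := intermediate_value_Ioo hε1.le hc.continuousOn ⟨hneg, hone⟩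
  refine ⟨δ, hδ.1, hδ.2, fun δ' hδ' => ?_⟩
  rw [hiff]
  refine ⟨fun h => hmono.injOn hδ' (Set.mem_Ici.2 hδ.1.le) (h.trans hδ0.symm), ?_⟩
  rintro rfl
  exact hδ0

/-- All factors in (2) are positive, so logarithms turn it into R(δ) = c with R strictly decreasing.
At ε the value exceeds c, and since c > 0 it drops below c for large δ. -/
theorem exists_deltaMinus {ε : ℝ} (hε : 0 < ε) :
    ∃ δ, ε < δ ∧ ∀ δ', ε ≤ δ' → (DeltaMinusEq ε δ' ↔ δ' = δ) := by
  set a := ε / √2 with ha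
  have ha0 : 0 < a := by positivity
  have haε : ε = √2 * a := by rw [ha]; field_simp
  have hea : Real.exp (-a) < 1 := by simpa using ha0
  set R : ℝ → ℝ := fun δ => Real.log (1 + √(δ ^ 2 - ε ^ 2)) - √(δ ^ 2 - ε ^ 2) -
    (Real.log (1 + δ) - δ) with hR
  set c := a - Real.log (2 - Real.exp (-a)) with hc
  have hc0 : 0 < c := by
    rw [hc, sub_pos, Real.log_lt_iff_lt_exp (by linarith)]
    have h1 : Real.exp a * Real.exp (-a) = 1 := by rw [← Real.exp_add]; simp
    have h3 : 1 < Real.exp a := by simpa using ha0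
    nlinarith
  have hiff : ∀ δ, ε ≤ δ → (DeltaMinusEq ε δ ↔ R δ = c) := fun δ hδ => by
    unfold DeltaMinusEq
    rw [sub_eq_zero, ← ha]
    have p1 : 0 < 1 + √(δ ^ 2 - ε ^ 2) := by positivity
    have p2 : 0 < 1 + δ := by linarith
    have p3 : 0 < 2 - Real.exp (-a) := by linarith
    rw [← Real.log_injOn_pos.eq_iff (Set.mem_Ioi.2 (by positivity)) (Set.mem_Ioi.2 (by positivity)),
      Real.log_mul (by positivity) (by positivity), Real.log_mul (by positivity) (by positivity),
      Real.log_mul (by positivity) (by positivity), Real.log_exp, Real.log_exp]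
    constructor <;> intro h <;> simp only [hR, hc] at * <;> linarith
  have hcont : ContinuousOn R (Set.Ici ε) := by
    intro δ hδ
    have p2 : 1 + δ ≠ 0 := by have : ε ≤ δ := hδ; linarith
    have p1 : 1 + √(δ ^ 2 - ε ^ 2) ≠ 0 := by positivity
    apply ContinuousAt.continuousWithinAt
    simp only [hR]
    fun_prop (disch := assumption)
  have hanti : StrictAntiOn R (Set.Ici ε) := by
    refine strictAntiOn_of_hasDerivWithinAt_neg (convex_Ici _) hcont
      (f' := fun δ => δ * ((1 + δ)⁻¹ - (1 + √(δ ^ 2 - ε ^ 2))⁻¹))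
      (fun δ hδ => HasDerivAt.hasDerivWithinAt ?_) fun δ hδ => ?_
    · rw [interior_Ici, Set.mem_Ioi] at hδ
      have hlt : ε ^ 2 < δ ^ 2 := by nlinarith
      have hs := Real.sqrt_pos.2 (sub_pos.2 hlt)
      have hds := hasDerivAt_sqrt_sq_sub_sq hlt
      have p1 : 1 + √(δ ^ 2 - ε ^ 2) ≠ 0 := by positivity
      have p2 : 1 + δ ≠ 0 := by linarith
      refine ((((hds.const_add 1).log p1).sub hds).sub
        ((((hasDerivAt_id δ).const_add 1).log p2).sub (hasDerivAt_id δ))).congr_deriv ?_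
      simp only [id]
      field_simp
      ring
    · rw [interior_Ici, Set.mem_Ioi] at hδ
      have hs : √(δ ^ 2 - ε ^ 2) < δ := by
        rw [Real.sqrt_lt' (by linarith)]; nlinarith
      refine mul_neg_of_pos_of_neg (by linarith) (sub_neg.2 ?_)
      exact inv_strictAnti₀ (by positivity) (by linarith)
  have hstart : c < R ε := by
    have h := strictMono_one_sub_mul_exp_add_exp (neg_lt_zero.2 ha0)
    simp only [mul_zero, sub_zero, Real.exp_zero, mul_one] at h
    simp only [hR, sub_self, Real.sqrt_zero, add_zero, Real.log_one, hc]
    have p3 : 0 < 2 - Real.exp (-a) := by linarith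
    have h4 : Real.log ((1 + ε) * Real.exp (a - ε)) < Real.log (2 - Real.exp (-a)) := by
      refine Real.log_lt_log (by positivity) ?_
      rw [show a - ε = (√2 - 1) * -a by rw [haε]; ring, haε]
      linarith
    rw [Real.log_mul (by positivity) (by positivity), Real.log_exp] at h4
    linarith
  -- Chosen so that cM > ε². With s = √(M² - ε²) one has (M - s)(M + s) = ε², hence M - s < c, and
  -- R(M) < M - s.
  set M := ε + ε ^ 2 / c with hM
  have hMε : ε < M := by rw [hM]; have : 0 < ε ^ 2 / c := by positivity
                         linarith
  have hend : R M < c := by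
    have hlt : ε ^ 2 < M ^ 2 := by nlinarith
    have hs : √(M ^ 2 - ε ^ 2) < M := by
      rw [Real.sqrt_lt' (by linarith)]; nlinarith
    have hsq := Real.sq_sqrt (sub_pos.2 hlt).le
    have hs0 := Real.sqrt_nonneg (M ^ 2 - ε ^ 2)
    simp only [hR]
    generalize √(M ^ 2 - ε ^ 2) = s at *
    have h1 : Real.log (1 + s) < Real.log (1 + M) := Real.log_lt_log (by linarith) (by linarith)
    have h5 : ε ^ 2 < c * M := by
      rw [hM, mul_add, mul_div_cancel₀ _ hc0.ne']
      have : 0 < c * ε := by positivity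
      linarith
    have h6 : M - s < c := by
      by_contra! h7
      nlinarith
    linarith
  obtain ⟨δ, hδ, hδ0⟩ := intermediate_value_Ioo' hMε.le
    (hcont.mono Set.Icc_subset_Ici_self) ⟨hend, hstart⟩
  refine ⟨δ, hδ.1, fun δ' hδ' => ?_⟩
  rw [hiff δ' hδ']
  refine ⟨fun h => hanti.injOn hδ' (Set.mem_Ici.2 hδ.1.le) (h.trans hδ0.symm), ?_⟩
  rintro rfl
  exact hδ0

/-! ### Means over dyadic intervals -/

/-- The mean of `f` over the interval with endpoints `l` and `u`. -/
noncomputable def intervalMean (f : ℝ → ℝ) (l u : ℝ) : ℝ := (∫ t in l..u, f t) / (u - l)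

theorem setAverage_Ioc_eq_intervalMean (f : ℝ → ℝ) {l u : ℝ} (h : l ≤ u) :
    ⨍ t in Set.Ioc l u, f t = intervalMean f l u := by
  rw [setAverage_eq, Real.volume_real_Ioc_of_le h, intervalMean,
    intervalIntegral.integral_of_le h, smul_eq_mul, div_eq_inv_mul]

theorem intervalMean_midpoint {f : ℝ → ℝ} {l m u : ℝ} (hf : IntervalIntegrable f volume l u)
    (hlu : l < u) (hm : m = (l + u) / 2) :
    intervalMean f l u = (intervalMean f l m + intervalMean f m u) / 2 := by
  have hmem : m ∈ Set.uIcc l u := by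
    rw [Set.uIcc_of_le hlu.le]; constructor <;> linarith
  have h1 := hf.mono_set (Set.uIcc_subset_uIcc_left hmem)
  have h2 := hf.mono_set (Set.uIcc_subset_uIcc_right hmem)
  unfold intervalMean
  rw [← intervalIntegral.integral_add_adjacent_intervals h1 h2,
    show m - l = (u - l) / 2 by rw [hm]; ring, show u - m = (u - l) / 2 by rw [hm]; ring]
  have : u - l ≠ 0 := by linarith
  field_simp

theorem intervalMean_const (c : ℝ) {l u : ℝ} (h : l < u) : intervalMean (fun _ => c) l u = c := by
  have : u - l ≠ 0 := by linarith
  simp [intervalMean, this]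

theorem intervalMean_sub_sq {φ : ℝ → ℝ} {l u : ℝ} (hlu : l < u)
    (h1 : IntervalIntegrable φ volume l u)
    (h2 : IntervalIntegrable (fun t => φ t ^ 2) volume l u) :
    intervalMean (fun t => (φ t - intervalMean φ l u) ^ 2) l u =
      intervalMean (fun t => φ t ^ 2) l u - intervalMean φ l u ^ 2 := by
  have hne : u - l ≠ 0 := by linarith
  set m := intervalMean φ l u with hm
  have hmI : (∫ t in l..u, φ t) = m * (u - l) := by
    rw [hm, intervalMean, div_mul_cancel₀ _ hne]
  have : ∫ t in l..u, (φ t - m) ^ 2 = (∫ t in l..u, φ t ^ 2) - m ^ 2 * (u - l) := by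
    have e : (fun t => (φ t - m) ^ 2) = fun t => (φ t ^ 2 - (2 * m) * φ t) + m ^ 2 := by
      funext t; ring
    rw [e, intervalIntegral.integral_add (h2.sub (h1.const_mul _)) intervalIntegrable_const,
      intervalIntegral.integral_sub h2 (h1.const_mul _), intervalIntegral.integral_const_mul, hmI,
      intervalIntegral.integral_const]
    simp only [smul_eq_mul]; ring
  rw [intervalMean, this, intervalMean]
  field_simp

theorem meanSqOsc_Ioc {φ : ℝ → ℝ} {l u : ℝ} (hlu : l < u)
    (h1 : IntervalIntegrable φ volume l u)
    (h2 : IntervalIntegrable (fun t => φ t ^ 2) volume l u) :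
    meanSqOsc φ (Set.Ioc l u) =
      ENNReal.ofReal (intervalMean (fun t => φ t ^ 2) l u - intervalMean φ l u ^ 2) := by
  rw [meanSqOsc, ← intervalMean_sub_sq hlu h1 h2, setAverage_Ioc_eq_intervalMean φ hlu.le,
    ← setAverage_Ioc_eq_intervalMean (fun t => (φ t - intervalMean φ l u) ^ 2) hlu.le,
    laverage_eq, ofReal_average]
  · have : IntervalIntegrable (fun t => (φ t - intervalMean φ l u) ^ 2) volume l u := by
      have e : (fun t => (φ t - intervalMean φ l u) ^ 2) = fun t =>
          (φ t ^ 2 - (2 * intervalMean φ l u) * φ t) + intervalMean φ l u ^ 2 := by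
        funext t; ring
      rw [e]
      exact (h2.sub (h1.const_mul _)).add intervalIntegrable_const
    exact (intervalIntegrable_iff_integrableOn_Ioc_of_le hlu.le).1 this
  · exact Filter.Eventually.of_forall fun t => sq_nonneg _

/-- The left endpoint of the `k`-th dyadic interval of generation `n`. -/
noncomputable def dyadicPoint (a b : ℝ) (n k : ℕ) : ℝ := a + (k : ℝ) * ((b - a) / 2 ^ n)

theorem dyadicInterval_eq (a b : ℝ) (n k : ℕ) :
    dyadicInterval a b n k = Set.Ioc (dyadicPoint a b n k) (dyadicPoint a b n (k + 1)) := by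
  simp [dyadicInterval, dyadicPoint]

theorem dyadicPoint_succ_sub (a b : ℝ) (n k : ℕ) :
    dyadicPoint a b n (k + 1) - dyadicPoint a b n k = (b - a) / 2 ^ n := by
  simp only [dyadicPoint]; push_cast; ring

theorem dyadicPoint_lt_succ {a b : ℝ} (hab : a < b) (n k : ℕ) :
    dyadicPoint a b n k < dyadicPoint a b n (k + 1) := by
  rw [← sub_pos, dyadicPoint_succ_sub]
  have := sub_pos.2 hab
  positivity

theorem dyadicPoint_monotone {a b : ℝ} (hab : a < b) (n : ℕ) : Monotone (dyadicPoint a b n) :=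
  (strictMono_nat_of_lt_succ (dyadicPoint_lt_succ hab n)).monotone

theorem dyadicPoint_zero (a b : ℝ) (n : ℕ) : dyadicPoint a b n 0 = a := by simp [dyadicPoint]

theorem dyadicPoint_two_pow (a b : ℝ) (n : ℕ) : dyadicPoint a b n (2 ^ n) = b := by
  simp only [dyadicPoint]; push_cast; field_simp; ring

theorem dyadicPoint_succ_two_mul (a b : ℝ) (n k : ℕ) :
    dyadicPoint a b (n + 1) (2 * k) = dyadicPoint a b n k := by
  simp only [dyadicPoint]; push_cast; rw [pow_succ]; field_simp

theorem dyadicPoint_succ_two_mul_add_one (a b : ℝ) (n k : ℕ) :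
    dyadicPoint a b (n + 1) (2 * k + 1) =
      (dyadicPoint a b n k + dyadicPoint a b n (k + 1)) / 2 := by
  simp only [dyadicPoint]; push_cast; rw [pow_succ]; field_simp; ring

theorem uIcc_dyadicPoint_subset {a b : ℝ} (hab : a < b) {n k : ℕ} (hk : k < 2 ^ n) :
    Set.uIcc (dyadicPoint a b n k) (dyadicPoint a b n (k + 1)) ⊆ Set.uIcc a b := by
  rw [Set.uIcc_of_le (dyadicPoint_lt_succ hab n k).le, Set.uIcc_of_le hab.le]
  refine Set.Icc_subset_Icc ?_ ?_
  · exact (dyadicPoint_zero a b n).symm.trans_le (dyadicPoint_monotone hab n (Nat.zero_le k))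
  · exact (dyadicPoint_monotone hab n hk).trans_eq (dyadicPoint_two_pow a b n)

/-- The mean of `f` over the `k`-th dyadic interval of generation `n`. -/
noncomputable def dyadicMean (a b : ℝ) (f : ℝ → ℝ) (n k : ℕ) : ℝ :=
  intervalMean f (dyadicPoint a b n k) (dyadicPoint a b n (k + 1))

theorem dyadicMean_zero (a b : ℝ) (f : ℝ → ℝ) : dyadicMean a b f 0 0 = intervalMean f a b := by
  simp [dyadicMean, dyadicPoint]

theorem dyadicMean_eq_midpoint {a b : ℝ} (hab : a < b) {f : ℝ → ℝ}
    (hf : IntervalIntegrable f volume a b) {n k : ℕ} (hk : k < 2 ^ n) :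
    dyadicMean a b f n k =
      (dyadicMean a b f (n + 1) (2 * k) + dyadicMean a b f (n + 1) (2 * k + 1)) / 2 := by
  have h := intervalMean_midpoint (hf.mono_set (uIcc_dyadicPoint_subset hab hk))
    (dyadicPoint_lt_succ hab n k) (dyadicPoint_succ_two_mul_add_one a b n k)
  rw [dyadicMean, h, dyadicMean, dyadicMean, dyadicPoint_succ_two_mul,
    show 2 * k + 1 + 1 = 2 * (k + 1) by ring, dyadicPoint_succ_two_mul]

/-- The pair of means of `φ` and `φ ^ 2` over a dyadic interval. -/
noncomputable def dyadicMeanPair (a b : ℝ) (φ : ℝ → ℝ) (n k : ℕ) : ℝ × ℝ :=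
  (dyadicMean a b φ n k, dyadicMean a b (fun t => φ t ^ 2) n k)

theorem dyadicBMONorm_le_iff {a b ε : ℝ} (hε : 0 ≤ ε) (φ : ℝ → ℝ) :
    dyadicBMONorm a b φ ≤ ENNReal.ofReal ε ↔ ∀ n k, k < 2 ^ n →
      meanSqOsc φ (dyadicInterval a b n k) ≤ ENNReal.ofReal (ε ^ 2) := by
  unfold dyadicBMONorm
  rw [one_div, ENNReal.rpow_inv_le_iff two_pos, ENNReal.rpow_two, ← ENNReal.ofReal_pow hε]
  simp only [iSup_le_iff]

theorem meanSqOsc_dyadicInterval {a b : ℝ} (hab : a < b) {φ : ℝ → ℝ}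
    (h1 : IntervalIntegrable φ volume a b)
    (h2 : IntervalIntegrable (fun t => φ t ^ 2) volume a b) {n k : ℕ} (hk : k < 2 ^ n) :
    meanSqOsc φ (dyadicInterval a b n k) = ENNReal.ofReal
      ((dyadicMeanPair a b φ n k).2 - (dyadicMeanPair a b φ n k).1 ^ 2) := by
  have hs := uIcc_dyadicPoint_subset hab hk
  rw [dyadicInterval_eq, meanSqOsc_Ioc (dyadicPoint_lt_succ hab n k) (h1.mono_set hs)
    (h2.mono_set hs)]
  rfl

/-- Finite oscillation makes (φ - m)² integrable, and φ² differs from it by an affine function of φ.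
Without this the Bochner average of φ² could be a default 0. -/
theorem integrableOn_sq_of_meanSqOsc_ne_top {φ : ℝ → ℝ} {l u : ℝ} 
    (h1 : IntegrableOn φ (Set.Ioc l u)) (h : meanSqOsc φ (Set.Ioc l u) ≠ ⊤) :
    IntegrableOn (fun t => φ t ^ 2) (Set.Ioc l u) := by
  unfold meanSqOsc at h
  set m := ⨍ t in Set.Ioc l u, φ t
  rw [laverage_eq] at h
  have hfin : ∫⁻ s in Set.Ioc l u, ENNReal.ofReal ((φ s - m) ^ 2) < ⊤ := by
    by_contra! h'
    rw [top_le_iff] at h'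
    rw [h', ENNReal.top_div_of_ne_top (by simp)] at h
    exact h rfl
  have hm : IntegrableOn (fun t => (φ t - m) ^ 2) (Set.Ioc l u) := by
    refine ⟨(h1.aestronglyMeasurable.sub aestronglyMeasurable_const).pow 2, ?_⟩
    rw [hasFiniteIntegral_iff_ofReal (Filter.Eventually.of_forall fun t => sq_nonneg _)]
    exact hfin
  have e : (fun t => φ t ^ 2) = fun t => (φ t - m) ^ 2 + (2 * m * φ t - m ^ 2) := by
    funext t; ring
  rw [e]
  exact hm.add ((h1.const_mul (2 * m)).sub (integrableOn_const (by simp)))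

/-- The oscillation over J is ⟨φ²⟩_J - ⟨φ⟩_J². The norm condition therefore bounds the pair of means
from above, and nonnegativity of the variance bounds it from below. -/
theorem mem_dyadicAdmissible_iff {a b ε : ℝ} (hab : a < b) (hε : 0 ≤ ε) {x : ℝ × ℝ}
    {φ : ℝ → ℝ} : φ ∈ dyadicAdmissible a b ε x ↔
      IntervalIntegrable φ volume a b ∧ IntervalIntegrable (fun t => φ t ^ 2) volume a b ∧
      (∀ n k, k < 2 ^ n → dyadicMeanPair a b φ n k ∈ bellmanDomain ε) ∧
      dyadicMeanPair a b φ 0 0 = x := by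
  have hpair : dyadicMeanPair a b φ 0 0 = x ↔
      (⨍ s in Set.Ioc a b, φ s) = x.1 ∧ (⨍ s in Set.Ioc a b, φ s ^ 2) = x.2 := by
    rw [dyadicMeanPair, dyadicMean_zero, dyadicMean_zero, Prod.ext_iff,
      setAverage_Ioc_eq_intervalMean _ hab.le, setAverage_Ioc_eq_intervalMean _ hab.le]
  rw [hpair]
  simp only [dyadicAdmissible, dyadicBMOBall, Set.mem_ofPred_eq, dyadicBMONorm_le_iff hε,
    ← intervalIntegrable_iff_integrableOn_Ioc_of_le hab.le, and_assoc]
  refine and_congr_right fun h1 => ?_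
  constructor
  · rintro ⟨h2, h3⟩
    have hsq : IntervalIntegrable (fun t => φ t ^ 2) volume a b := by
      rw [intervalIntegrable_iff_integrableOn_Ioc_of_le hab.le] at h1 ⊢
      refine integrableOn_sq_of_meanSqOsc_ne_top h1 ?_
      have h0 := h2 0 0 (by simp)
      rw [dyadicInterval_eq, dyadicPoint_zero, show 0 + 1 = 2 ^ 0 by rfl, dyadicPoint_two_pow] at h0
      exact ne_top_of_le_ne_top ENNReal.ofReal_ne_top h0
    refine ⟨hsq, fun n k hk => ?_, h3⟩
    have h4 := h2 n k hk
    rw [meanSqOsc_dyadicInterval hab h1 hsq hk, ENNReal.ofReal_le_ofReal_iff (sq_nonneg _)] at h4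
    refine ⟨?_, by linarith⟩
    have hs := uIcc_dyadicPoint_subset hab hk
    have hlt := dyadicPoint_lt_succ hab n k
    have hvar := intervalMean_sub_sq hlt (h1.mono_set hs) (hsq.mono_set hs)
    rw [← sub_nonneg]
    refine le_of_le_of_eq ?_ hvar
    exact div_nonneg (intervalIntegral.integral_nonneg hlt.le fun t _ => sq_nonneg _)
      (sub_nonneg.2 hlt.le)
  · rintro ⟨hsq, h2, h3⟩
    refine ⟨fun n k hk => ?_, h3⟩
    rw [meanSqOsc_dyadicInterval hab h1 hsq hk]
    exact ENNReal.ofReal_le_ofReal (by linarith [(h2 n k hk).2])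

/-! ### Dyadic supermartingales and their limits -/

theorem sum_range_two_pow_le {c : ℕ → ℕ → ℝ}
    (hc : ∀ n k, k < 2 ^ n → (c (n + 1) (2 * k) + c (n + 1) (2 * k + 1)) / 2 ≤ c n k) (n : ℕ) :
    ∑ k ∈ Finset.range (2 ^ n), c n k ≤ 2 ^ n * c 0 0 := by
  have hsplit : ∀ (f : ℕ → ℝ) (m : ℕ), ∑ k ∈ Finset.range (2 * m), f k =
      ∑ k ∈ Finset.range m, (f (2 * k) + f (2 * k + 1)) := by
    intro f m
    induction m with
    | zero => simp
    | succ m ih =>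
      rw [Finset.sum_range_succ, ← ih, show 2 * (m + 1) = 2 * m + 1 + 1 by ring,
        Finset.sum_range_succ, Finset.sum_range_succ, add_assoc]
  induction n with
  | zero => simp
  | succ n ih =>
    rw [pow_succ', hsplit]
    calc ∑ k ∈ Finset.range (2 ^ n), (c (n + 1) (2 * k) + c (n + 1) (2 * k + 1))
        ≤ ∑ k ∈ Finset.range (2 ^ n), 2 * c n k := Finset.sum_le_sum fun k hk => by
          linarith [hc n k (Finset.mem_range.1 hk)]
      _ = 2 * ∑ k ∈ Finset.range (2 ^ n), c n k := by rw [Finset.mul_sum]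
      _ ≤ 2 ^ (n + 1) * c 0 0 := by rw [pow_succ']; linarith

theorem exists_mem_dyadicInterval {a b s : ℝ} (hs : s ∈ Set.Ioc a b) (n : ℕ) :
    ∃ k < 2 ^ n, s ∈ dyadicInterval a b n k := by
  have hex : ∃ k, s ≤ dyadicPoint a b n k := ⟨2 ^ n, (dyadicPoint_two_pow a b n).symm ▸ hs.2⟩
  classical
  obtain ⟨k, hk⟩ : ∃ k, Nat.find hex = k + 1 := by
    refine Nat.exists_eq_succ_of_ne_zero fun h => ?_
    have := Nat.find_spec hex
    rw [h, dyadicPoint_zero] at this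
    exact absurd hs.1 (not_lt.2 this)
  refine ⟨k, ?_, ?_⟩
  · have := Nat.find_min' hex ((dyadicPoint_two_pow a b n).symm ▸ hs.2)
    omega
  · rw [dyadicInterval_eq]
    refine ⟨not_le.1 (Nat.find_min hex (by omega)), ?_⟩
    rw [← hk]
    exact Nat.find_spec hex

theorem dyadicInterval_eq_of_mem {a b s : ℝ} (hab : a < b) {n j k : ℕ}
    (hj : s ∈ dyadicInterval a b n j) (hk : s ∈ dyadicInterval a b n k) : j = k := by
  rw [dyadicInterval_eq] at hj hk
  by_contra hne
  rcases lt_or_gt_of_ne hne with h | h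
  · exact absurd hk.1 (not_lt.2 (hj.2.trans (dyadicPoint_monotone hab n h)))
  · exact absurd hj.1 (not_lt.2 (hk.2.trans (dyadicPoint_monotone hab n h)))

/-- Fatou's lemma for dyadic step functions. -/
theorem laverage_le_of_dyadic_tendsto {a b : ℝ} (hab : a < b) {c : ℕ → ℕ → ℝ} {h : ℝ → ℝ} {M : ℝ}
    (hc : ∀ n k, k < 2 ^ n → 0 ≤ c n k)
    (hM : ∀ n, ∑ k ∈ Finset.range (2 ^ n), c n k ≤ 2 ^ n * M)
    (hlim : ∀ᵐ s ∂volume.restrict (Set.Ioc a b), ∀ k : ℕ → ℕ,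
      (∀ n, k n < 2 ^ n ∧ s ∈ dyadicInterval a b n (k n)) →
      Filter.Tendsto (fun n => c n (k n)) Filter.atTop (nhds (h s))) :
    ⨍⁻ s, ENNReal.ofReal (h s) ∂(volume.restrict (Set.Ioc a b)) ≤ ENNReal.ofReal M := by
  set F : ℕ → ℝ → ℝ≥0∞ := fun n s => ∑ k ∈ Finset.range (2 ^ n),
    (dyadicInterval a b n k).indicator (fun _ => ENNReal.ofReal (c n k)) s with hF
  have hmeas : ∀ n k, MeasurableSet (dyadicInterval a b n k) := fun n k => measurableSet_Ioc
  have hFm : ∀ n, Measurable (F n) := fun n =>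
    Finset.measurable_sum _ fun k _ => measurable_const.indicator (hmeas n k)
  have hFint : ∀ n, ∫⁻ s in Set.Ioc a b, F n s ≤ ENNReal.ofReal (M * (b - a)) := by
    intro n
    have hh : 0 ≤ (b - a) / 2 ^ n := div_nonneg (by linarith) (by positivity)
    calc ∫⁻ s in Set.Ioc a b, F n s ≤ ∫⁻ s, F n s := setLIntegral_le_lintegral _ _
      _ = ∑ k ∈ Finset.range (2 ^ n), ENNReal.ofReal (c n k * ((b - a) / 2 ^ n)) := by
        rw [lintegral_finsetSum _ fun k _ => measurable_const.indicator (hmeas n k)]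
        refine Finset.sum_congr rfl fun k hk => ?_
        rw [lintegral_indicator_const (hmeas n k), dyadicInterval_eq, Real.volume_Ioc,
          dyadicPoint_succ_sub, ← ENNReal.ofReal_mul (hc n k (Finset.mem_range.1 hk))]
      _ = ENNReal.ofReal ((∑ k ∈ Finset.range (2 ^ n), c n k) * ((b - a) / 2 ^ n)) := by
        rw [Finset.sum_mul, ENNReal.ofReal_sum_of_nonneg fun k hk =>
          mul_nonneg (hc n k (Finset.mem_range.1 hk)) hh]
      _ ≤ ENNReal.ofReal (M * (b - a)) := by
        refine ENNReal.ofReal_le_ofReal ?_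
        refine (mul_le_mul_of_nonneg_right (hM n) hh).trans_eq ?_
        field_simp
  have hval : ∀ n k s, k < 2 ^ n → s ∈ dyadicInterval a b n k →
      F n s = ENNReal.ofReal (c n k) := by
    intro n k s hk hs
    simp only [hF]
    rw [Finset.sum_eq_single_of_mem k (Finset.mem_range.2 hk)]
    · simp [hs]
    · intro j _ hjk
      exact Set.indicator_of_notMem (fun hj => hjk (dyadicInterval_eq_of_mem hab hj hs)) _
  have hpt : ∀ᵐ s ∂volume.restrict (Set.Ioc a b),
      ENNReal.ofReal (h s) = Filter.liminf (fun n => F n s) Filter.atTop := by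
    filter_upwards [hlim, ae_restrict_mem measurableSet_Ioc] with s hs hsI
    choose k hk1 hk2 using exists_mem_dyadicInterval hsI
    have ht := hs k fun n => ⟨hk1 n, hk2 n⟩
    have ht2 : Filter.Tendsto (fun n => F n s) Filter.atTop (nhds (ENNReal.ofReal (h s))) := by
      simp only [fun n => hval n (k n) s (hk1 n) (hk2 n)]
      exact ENNReal.tendsto_ofReal ht
    exact ht2.liminf_eq.symm
  rw [setLAverage_eq, lintegral_congr_ae hpt, Real.volume_Ioc]
  have hba : 0 < b - a := sub_pos.2 hab
  refine ENNReal.div_le_of_le_mul ?_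
  have hM0 : 0 ≤ M := by
    have := (hc 0 0 (by simp)).trans (by simpa using hM 0)
    exact this
  rw [← ENNReal.ofReal_mul hM0]
  refine (lintegral_liminf_le hFm).trans ?_
  refine (Filter.liminf_le_liminf (Filter.Eventually.of_forall hFint)).trans_eq ?_
  simp

/-- Lebesgue's differentiation theorem along dyadic intervals. -/
theorem ae_tendsto_dyadicMean {a b : ℝ} (hab : a < b) {f : ℝ → ℝ}
    (hf : IntervalIntegrable f volume a b) :
    ∀ᵐ s ∂volume.restrict (Set.Ioc a b), ∀ k : ℕ → ℕ,
      (∀ n, k n < 2 ^ n ∧ s ∈ dyadicInterval a b n (k n)) →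
      Filter.Tendsto (fun n => dyadicMean a b f n (k n)) Filter.atTop (nhds (f s)) := by
  rw [intervalIntegrable_iff_integrableOn_Ioc_of_le hab.le] at hf
  -- The differentiation theorem works on the whole line, so f is cut off outside the interval; the
  -- averages involved do not change.
  have hloc : LocallyIntegrable ((Set.Ioc a b).indicator f) volume :=
    (hf.integrable_indicator measurableSet_Ioc).locallyIntegrable
  filter_upwards [ae_restrict_of_ae (IsUnifLocDoublingMeasure.ae_tendsto_average volume hloc 1),
    ae_restrict_mem measurableSet_Ioc] with s hs hsI k hk
  have hba : 0 < b - a := sub_pos.2 hab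
  have h0 : Filter.Tendsto (fun n : ℕ => (b - a) / 2 ^ n / 2) Filter.atTop
      (nhdsWithin 0 (Set.Ioi 0)) := by
    rw [tendsto_nhdsWithin_iff]
    refine ⟨?_, Filter.Eventually.of_forall fun n => Set.mem_Ioi.2 (by positivity)⟩
    have := (tendsto_inv_atTop_zero.comp (tendsto_pow_atTop_atTop_of_one_lt
      (one_lt_two (α := ℝ)))).const_mul ((b - a) / 2)
    simp only [mul_zero] at this
    refine this.congr fun n => ?_
    simp only [Function.comp]
    field_simp
  have hball : ∀ n, Metric.closedBall
      ((dyadicPoint a b n (k n) + dyadicPoint a b n (k n + 1)) / 2) ((b - a) / 2 ^ n / 2) =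
      Set.Icc (dyadicPoint a b n (k n)) (dyadicPoint a b n (k n + 1)) := by
    intro n
    have := dyadicPoint_succ_sub a b n (k n)
    rw [Real.closedBall_eq_Icc]
    congr 1 <;> linarith
  have key := hs (fun n => (dyadicPoint a b n (k n) + dyadicPoint a b n (k n + 1)) / 2)
    (fun n => (b - a) / 2 ^ n / 2) h0 (Filter.Eventually.of_forall fun n => by
      rw [one_mul, hball]
      have := (hk n).2
      rw [dyadicInterval_eq] at this
      exact Set.Ioc_subset_Icc_self this)
  rw [Set.indicator_of_mem hsI] at key
  refine key.congr fun n => ?_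
  rw [hball, ← setAverage_congr (Ioc_ae_eq_Icc (μ := volume)), dyadicMean,
    ← setAverage_Ioc_eq_intervalMean _ (dyadicPoint_lt_succ hab n _).le, setAverage_eq,
    setAverage_eq]
  congr 1
  refine setIntegral_congr_fun measurableSet_Ioc fun t ht => Set.indicator_of_mem ?_ f
  have h1 := uIcc_dyadicPoint_subset hab (hk n).1
  rw [Set.uIcc_of_le (dyadicPoint_lt_succ hab n _).le, Set.uIcc_of_le hab.le] at h1
  have h3 := (dyadicPoint_zero a b n).symm.trans_le
    (dyadicPoint_monotone hab n (Nat.zero_le (k n)))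
  exact ⟨h3.trans_lt ht.1, (h1 (Set.Ioc_subset_Icc_self ht)).2⟩

/-! ### The candidates bound every exponential average -/

theorem bellmanCandidate_dyadicMeanPair_midpoint {κ δ ε a b : ℝ} (hab : a < b) {φ : ℝ → ℝ} {x : ℝ × ℝ}
    (hκ : κ ^ 2 = 1) (hε : 0 < ε) (hδ : ε < δ) (hpos : 0 < bellmanProfile κ δ)
    (heq : bellmanProfile κ √(δ ^ 2 - ε ^ 2) * (2 - Real.exp (κ * (ε / √2))) =
      bellmanProfile κ δ * Real.exp (-(κ * (ε / √2))))
    (hφ : φ ∈ dyadicAdmissible a b ε x) {n k : ℕ} (hk : k < 2 ^ n) :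
    0 ≤ κ * (2 * bellmanCandidate κ δ (dyadicMeanPair a b φ n k)
      - bellmanCandidate κ δ (dyadicMeanPair a b φ (n + 1) (2 * k))
      - bellmanCandidate κ δ (dyadicMeanPair a b φ (n + 1) (2 * k + 1))) := by
  rw [mem_dyadicAdmissible_iff hab hε.le] at hφ
  obtain ⟨h1, h2, h3, -⟩ := hφ
  have hpow : 2 ^ (n + 1) = 2 * 2 ^ n := pow_succ' 2 n
  exact bellmanCandidate_midpoint hκ hε hδ hpos heq (h3 n k hk) (h3 _ _ (by omega))
    (h3 _ _ (by omega)) (dyadicMean_eq_midpoint hab h1 hk) (dyadicMean_eq_midpoint hab h2 hk)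

/-- The step functions e^{⟨φ⟩_J} converge to e^φ almost everywhere and lie below the candidate at
the points of J, whose averages over a generation are at most B(x). Fatou finishes, with no
integrability of e^φ assumed. -/
theorem expAverage_le_bellmanCandidate {δ ε a b : ℝ} (hab : a < b) {φ : ℝ → ℝ} {x : ℝ × ℝ}
    (hε : 0 < ε) (hδ : ε < δ) (hpos : 0 < bellmanProfile 1 δ)
    (heq : bellmanProfile 1 √(δ ^ 2 - ε ^ 2) * (2 - Real.exp (1 * (ε / √2))) =
      bellmanProfile 1 δ * Real.exp (-(1 * (ε / √2))))
    (hφ : φ ∈ dyadicAdmissible a b ε x) :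
    expAverage a b φ ≤ ENNReal.ofReal (bellmanCandidate 1 δ x) := by
  have hφ' := (mem_dyadicAdmissible_iff hab hε.le).1 hφ
  obtain ⟨h1, h2, h3, hx⟩ := hφ'
  refine laverage_le_of_dyadic_tendsto hab (c := fun n k => Real.exp (dyadicMean a b φ n k))
    (fun n k _ => (Real.exp_pos _).le) (fun n => ?_) ?_
  · rw [← hx]
    refine (Finset.sum_le_sum fun k hk => ?_).trans
      (sum_range_two_pow_le (c := fun n k => bellmanCandidate 1 δ (dyadicMeanPair a b φ n k))
        (fun n k hk => ?_) n)
    · exact exp_le_bellmanCandidate (hε.trans hδ).le hpos (h3 n k (Finset.mem_range.1 hk))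
    · have := bellmanCandidate_dyadicMeanPair_midpoint hab (one_pow 2) hε hδ hpos heq hφ hk
      linarith
  · filter_upwards [ae_tendsto_dyadicMean hab h1] with s hs k hk
    exact (Real.continuous_exp.tendsto _).comp (hs k hk)

theorem exp_intervalMean_le {φ : ℝ → ℝ} {l u : ℝ} (hlu : l < u)
    (h1 : IntervalIntegrable φ volume l u)
    (h2 : IntervalIntegrable (fun t => Real.exp (φ t)) volume l u) :
    Real.exp (intervalMean φ l u) ≤ intervalMean (fun t => Real.exp (φ t)) l u := by
  rw [intervalIntegrable_iff_integrableOn_Ioc_of_le hlu.le] at h1 h2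
  rw [← setAverage_Ioc_eq_intervalMean _ hlu.le, ← setAverage_Ioc_eq_intervalMean _ hlu.le]
  exact convexOn_exp.map_set_average_le Real.continuous_exp.continuousOn isClosed_univ
    (by simp [hlu]) (by simp) (by simp) h1 h2

theorem expAverage_eq_ofReal {a b : ℝ} (hab : a < b) {φ : ℝ → ℝ}
    (h : IntervalIntegrable (fun t => Real.exp (φ t)) volume a b) :
    expAverage a b φ = ENNReal.ofReal (intervalMean (fun t => Real.exp (φ t)) a b) := by
  rw [expAverage, laverage_eq, ← setAverage_Ioc_eq_intervalMean _ hab.le, ofReal_average]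
  · exact (intervalIntegrable_iff_integrableOn_Ioc_of_le hab.le).1 h
  · exact Filter.Eventually.of_forall fun t => (Real.exp_pos _).le

theorem intervalIntegrable_exp_of_expAverage_ne_top {a b : ℝ} (hab : a < b) {φ : ℝ → ℝ}
    (h1 : IntervalIntegrable φ volume a b) (h : expAverage a b φ ≠ ⊤) :
    IntervalIntegrable (fun t => Real.exp (φ t)) volume a b := by
  rw [intervalIntegrable_iff_integrableOn_Ioc_of_le hab.le] at h1 ⊢
  refine ⟨Real.continuous_exp.comp_aestronglyMeasurable h1.aestronglyMeasurable, ?_⟩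
  rw [hasFiniteIntegral_iff_ofReal (Filter.Eventually.of_forall fun t => (Real.exp_pos _).le)]
  by_contra! h'
  rw [top_le_iff] at h'
  rw [expAverage, laverage_eq, h', ENNReal.top_div_of_ne_top (by simp)] at h
  exact h rfl

/-- Fatou points the wrong way for a lower bound, so it is applied to C⟨e^φ⟩_J - B with C = 1/b(δ).
This is nonnegative by Jensen and B ≤ Ce^{x₁}, has the supermartingale property, and tends to (C -
1)e^φ. Cancelling C⟨e^φ⟩ leaves the claim. -/
theorem bellmanCandidate_le_expAverage {δ ε a b : ℝ} (hab : a < b) {φ : ℝ → ℝ} {x : ℝ × ℝ}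
    (hε : 0 < ε) (hδ : ε < δ) (hpos : 0 < bellmanProfile (-1) δ)
    (heq : bellmanProfile (-1) √(δ ^ 2 - ε ^ 2) * (2 - Real.exp (-1 * (ε / √2))) =
      bellmanProfile (-1) δ * Real.exp (-(-1 * (ε / √2))))
    (hφ : φ ∈ dyadicAdmissible a b ε x) :
    ENNReal.ofReal (bellmanCandidate (-1) δ x) ≤ expAverage a b φ := by
  by_cases htop : expAverage a b φ = ⊤
  · simp [htop]
  have hφ' := (mem_dyadicAdmissible_iff hab hε.le).1 hφ
  obtain ⟨h1, h2, h3, hx⟩ := hφ'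
  have hδ0 : 0 ≤ δ := (hε.trans hδ).le
  have hexp := intervalIntegrable_exp_of_expAverage_ne_top hab h1 htop
  rw [expAverage_eq_ofReal hab hexp]
  refine ENNReal.ofReal_le_ofReal ?_
  set C := (bellmanProfile (-1) δ)⁻¹ with hC
  set g : ℝ → ℝ := fun t => Real.exp (φ t) with hg
  have hC1 : 1 ≤ C := by
    rw [hC, one_le_inv₀ hpos]
    refine le_of_le_of_eq ?_ (bellmanProfile_zero (-1))
    exact bellmanProfile_antitoneOn _ (Set.mem_Ici.2 le_rfl) (Set.mem_Ici.2 hδ0) hδ0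
  set c : ℕ → ℕ → ℝ := fun n k => C * dyadicMean a b g n k -
    bellmanCandidate (-1) δ (dyadicMeanPair a b φ n k) with hc
  have hc0 : ∀ n k, k < 2 ^ n → 0 ≤ c n k := fun n k hk => by
    have hs := uIcc_dyadicPoint_subset hab hk
    have hJ : Real.exp (dyadicMean a b φ n k) ≤ dyadicMean a b g n k :=
      exp_intervalMean_le (dyadicPoint_lt_succ hab n k) (h1.mono_set hs) (hexp.mono_set hs)
    refine sub_nonneg.2 ((bellmanCandidate_le hpos).trans ?_)
    exact mul_le_mul_of_nonneg_left hJ (by linarith)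
  have key := laverage_le_of_dyadic_tendsto hab (c := c) (h := fun s => (C - 1) * g s)
    (M := c 0 0) hc0 (sum_range_two_pow_le fun n k hk => by
      have e1 := bellmanCandidate_dyadicMeanPair_midpoint hab (by norm_num) hε hδ hpos heq hφ hk
      have e2 := dyadicMean_eq_midpoint hab hexp hk
      simp only [hc, e2]
      linarith) (by
      filter_upwards [ae_tendsto_dyadicMean hab h1, ae_tendsto_dyadicMean hab h2,
        ae_tendsto_dyadicMean hab hexp] with s s1 s2 s3 k hk
      have hlim : bellmanCandidate (-1) δ (φ s, φ s ^ 2) = g s :=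
        bellmanCandidate_of_eq_sq hδ0 hpos rfl
      have := ((s3 k hk).const_mul C).sub (((continuous_bellmanCandidate (-1) δ).tendsto _).comp
        ((s1 k hk).prodMk_nhds (s2 k hk)))
      rw [hlim] at this
      rw [show (C - 1) * g s = C * g s - g s by ring]
      exact this)
  have hint : IntervalIntegrable (fun s => (C - 1) * g s) volume a b := hexp.const_mul _
  have hmean : intervalMean (fun s => (C - 1) * g s) a b = (C - 1) * intervalMean g a b := by
    simp [intervalMean, mul_div_assoc]
  rw [laverage_eq, ← ofReal_average, setAverage_Ioc_eq_intervalMean _ hab.le,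
    ENNReal.ofReal_le_ofReal_iff (hc0 0 0 (by simp)), hmean] at key
  · simp only [hc, hx, dyadicMean_zero] at key
    linarith
  · exact (intervalIntegrable_iff_integrableOn_Ioc_of_le hab.le).1 hint
  · exact Filter.Eventually.of_forall fun t =>
      mul_nonneg (by linarith) (Real.exp_pos _).le

/-! ### Values on the lower boundary -/

theorem ae_eq_of_mem_dyadicAdmissible_of_eq_sq {a b ε : ℝ} (hab : a < b) (hε : 0 ≤ ε) {φ : ℝ → ℝ}
    {x : ℝ × ℝ} (hx : x.2 = x.1 ^ 2) (hφ : φ ∈ dyadicAdmissible a b ε x) :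
    ∀ᵐ s ∂volume.restrict (Set.Ioc a b), φ s = x.1 := by
  obtain ⟨h1, h2, -, h4⟩ := (mem_dyadicAdmissible_iff hab hε).1 hφ
  have h5 : intervalMean φ a b = x.1 := by rw [← h4, ← dyadicMean_zero]; rfl
  have h6 : intervalMean (fun t => φ t ^ 2) a b = x.2 := by rw [← h4, ← dyadicMean_zero]; rfl
  have hm := meanSqOsc_Ioc hab h1 h2
  rw [h5, h6, hx, sub_self, ENNReal.ofReal_zero, meanSqOsc,
    setAverage_Ioc_eq_intervalMean _ hab.le, h5, laverage_eq, ENNReal.div_eq_zero_iff] at hm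
  have hφm := (intervalIntegrable_iff_integrableOn_Ioc_of_le hab.le).1 h1 |>.aestronglyMeasurable
  have hzero := hm.resolve_right (by simp)
  have hmeas : AEMeasurable (fun s => ENNReal.ofReal ((φ s - x.1) ^ 2))
      (volume.restrict (Set.Ioc a b)) :=
    ((hφm.aemeasurable.sub_const _).pow_const 2).ennreal_ofReal
  rw [lintegral_eq_zero_iff' hmeas] at hzero
  filter_upwards [hzero] with s hs
  simp only [Pi.zero_apply, ENNReal.ofReal_eq_zero] at hs
  have : (φ s - x.1) ^ 2 = 0 := le_antisymm hs (sq_nonneg _)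
  rw [sq_eq_zero_iff] at this
  linarith

theorem expAverage_of_mem_dyadicAdmissible_of_eq_sq {a b ε : ℝ} (hab : a < b) (hε : 0 ≤ ε)
    {φ : ℝ → ℝ} {x : ℝ × ℝ} (hx : x.2 = x.1 ^ 2) (hφ : φ ∈ dyadicAdmissible a b ε x) :
    expAverage a b φ = ENNReal.ofReal (Real.exp x.1) := by
  rw [expAverage, laverage_congr (g := fun _ => ENNReal.ofReal (Real.exp x.1)) (by
    filter_upwards [ae_eq_of_mem_dyadicAdmissible_of_eq_sq hab hε hx hφ] with s hs
    rw [hs])]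
  have : NeZero (volume.restrict (Set.Ioc a b)) := ⟨by simp [Measure.restrict_eq_zero, hab]⟩
  exact laverage_const _ _

theorem const_mem_dyadicAdmissible {a b ε : ℝ} (hab : a < b) (hε : 0 ≤ ε) {x : ℝ × ℝ}
    (hx : x.2 = x.1 ^ 2) : (fun _ => x.1) ∈ dyadicAdmissible a b ε x := by
  rw [mem_dyadicAdmissible_iff hab hε]
  have : ∀ n k, dyadicMeanPair a b (fun _ => x.1) n k = x := fun n k => by
    rw [dyadicMeanPair, dyadicMean, dyadicMean, intervalMean_const _ (dyadicPoint_lt_succ hab n k),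
      intervalMean_const _ (dyadicPoint_lt_succ hab n k), ← hx]
  refine ⟨intervalIntegrable_const, intervalIntegrable_const, fun n k _ => ?_, this 0 0⟩
  rw [this, bellmanDomain]
  exact ⟨hx.ge, by rw [hx]; linarith [sq_nonneg ε]⟩

theorem upperDyadicBellman_of_eq_sq {a b ε : ℝ} (hab : a < b) (hε : 0 ≤ ε) {x : ℝ × ℝ}
    (hx : x.2 = x.1 ^ 2) : upperDyadicBellman a b ε x = ENNReal.ofReal (Real.exp x.1) := by
  refine le_antisymm (iSup₂_le fun φ hφ => ?_) ?_
  · exact (expAverage_of_mem_dyadicAdmissible_of_eq_sq hab hε hx hφ).le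
  · rw [← expAverage_of_mem_dyadicAdmissible_of_eq_sq hab hε hx
      (const_mem_dyadicAdmissible hab hε hx)]
    exact le_iSup₂ (f := fun φ (_ : φ ∈ dyadicAdmissible a b ε x) => expAverage a b φ) _
      (const_mem_dyadicAdmissible hab hε hx)

theorem lowerDyadicBellman_of_eq_sq {a b ε : ℝ} (hab : a < b) (hε : 0 ≤ ε) {x : ℝ × ℝ}
    (hx : x.2 = x.1 ^ 2) : lowerDyadicBellman a b ε x = ENNReal.ofReal (Real.exp x.1) := by
  refine le_antisymm ?_ (le_iInf₂ fun φ hφ => ?_)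
  · rw [← expAverage_of_mem_dyadicAdmissible_of_eq_sq hab hε hx
      (const_mem_dyadicAdmissible hab hε hx)]
    exact iInf₂_le (f := fun φ (_ : φ ∈ dyadicAdmissible a b ε x) => expAverage a b φ) _
      (const_mem_dyadicAdmissible hab hε hx)
  · exact (expAverage_of_mem_dyadicAdmissible_of_eq_sq hab hε hx hφ).ge

/-! ### Concatenation and the midpoint inequality for the Bellman functions -/

theorem intervalMean_comp_two_mul_sub (f : ℝ → ℝ) (d l u : ℝ) :
    intervalMean (fun t => f (2 * t - d)) l u = intervalMean f (2 * l - d) (2 * u - d) := by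
  rw [intervalMean, intervalIntegral.integral_comp_mul_sub f two_ne_zero d, intervalMean,
    show 2 * u - d - (2 * l - d) = 2 * (u - l) by ring, smul_eq_mul]
  rw [mul_comm 2 (u - l), ← div_div]
  ring

theorem intervalMean_congr {f g : ℝ → ℝ} {l u : ℝ} (hlu : l ≤ u)
    (h : Set.EqOn f g (Set.Ioc l u)) : intervalMean f l u = intervalMean g l u := by
  rw [intervalMean, intervalMean, intervalIntegral.integral_of_le hlu,
    intervalIntegral.integral_of_le hlu, setIntegral_congr_fun measurableSet_Ioc h]

theorem intervalIntegrable_comp_two_mul_sub {f : ℝ → ℝ} {l u d : ℝ}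
    (hf : IntervalIntegrable f volume (2 * l - d) (2 * u - d)) :
    IntervalIntegrable (fun t => f (2 * t - d)) volume l u := by
  have h1 := (hf.comp_sub_right d).comp_mul_left (c := 2)
  simpa using h1

/-- The function on `(a, b]` that looks like `φ` on the left half and like `ψ` on the right half. -/
noncomputable def halvesConcat (a b : ℝ) (φ ψ : ℝ → ℝ) (s : ℝ) : ℝ :=
  if s ≤ (a + b) / 2 then φ (2 * s - a) else ψ (2 * s - b)

theorem halvesConcat_sq (a b : ℝ) (φ ψ : ℝ → ℝ) :
    (fun t => halvesConcat a b φ ψ t ^ 2) =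
      halvesConcat a b (fun t => φ t ^ 2) fun t => ψ t ^ 2 := by
  funext t
  simp only [halvesConcat]
  split_ifs <;> rfl

theorem halvesConcat_eqOn_left {a b u : ℝ} (φ ψ : ℝ → ℝ) (l : ℝ) (hu : u ≤ (a + b) / 2) :
    Set.EqOn (halvesConcat a b φ ψ) (fun t => φ (2 * t - a)) (Set.Ioc l u) := fun t ht => by
  simp [halvesConcat, ht.2.trans hu]

theorem halvesConcat_eqOn_right {a b l : ℝ} (φ ψ : ℝ → ℝ) (u : ℝ) (hl : (a + b) / 2 ≤ l) :
    Set.EqOn (halvesConcat a b φ ψ) (fun t => ψ (2 * t - b)) (Set.Ioc l u) := fun t ht => by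
  simp [halvesConcat, not_le.2 (hl.trans_lt ht.1)]

theorem intervalIntegrable_halvesConcat {a b : ℝ} (hab : a < b) {φ ψ : ℝ → ℝ}
    (hφ : IntervalIntegrable φ volume a b) (hψ : IntervalIntegrable ψ volume a b) :
    IntervalIntegrable (halvesConcat a b φ ψ) volume a b := by
  refine IntervalIntegrable.trans (b := (a + b) / 2) ?_ ?_
  · have h1 : IntervalIntegrable (fun t => φ (2 * t - a)) volume a ((a + b) / 2) :=
      intervalIntegrable_comp_two_mul_sub (by ring_nf; exact hφ)
    refine (intervalIntegrable_congr ?_).2 h1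
    rw [Set.uIoc_of_le (by linarith)]
    exact halvesConcat_eqOn_left φ ψ a le_rfl
  · have h1 : IntervalIntegrable (fun t => ψ (2 * t - b)) volume ((a + b) / 2) b :=
      intervalIntegrable_comp_two_mul_sub (by ring_nf; exact hψ)
    refine (intervalIntegrable_congr ?_).2 h1
    rw [Set.uIoc_of_le (by linarith)]
    exact halvesConcat_eqOn_right φ ψ b le_rfl

theorem two_mul_dyadicPoint_succ_sub (a b : ℝ) (n k : ℕ) :
    2 * dyadicPoint a b (n + 1) k - a = dyadicPoint a b n k := by
  simp only [dyadicPoint]; rw [pow_succ]; field_simp; ring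

theorem two_mul_dyadicPoint_succ_sub_right (a b : ℝ) (n k : ℕ) :
    2 * dyadicPoint a b (n + 1) (2 ^ n + k) - b = dyadicPoint a b n k := by
  simp only [dyadicPoint]; push_cast; rw [pow_succ]; field_simp; ring

theorem dyadicPoint_succ_two_pow (a b : ℝ) (n : ℕ) :
    dyadicPoint a b (n + 1) (2 ^ n) = (a + b) / 2 := by
  simp only [dyadicPoint]; push_cast; rw [pow_succ]; field_simp; ring

theorem dyadicMean_halvesConcat_left {a b : ℝ} (hab : a < b) (φ ψ : ℝ → ℝ) {n k : ℕ}
    (hk : k < 2 ^ n) : dyadicMean a b (halvesConcat a b φ ψ) (n + 1) k = dyadicMean a b φ n k := by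
  rw [dyadicMean, intervalMean_congr (dyadicPoint_lt_succ hab _ k).le
    (halvesConcat_eqOn_left φ ψ _ ?_), intervalMean_comp_two_mul_sub,
    two_mul_dyadicPoint_succ_sub, two_mul_dyadicPoint_succ_sub, dyadicMean]
  exact (dyadicPoint_monotone hab _ hk).trans_eq (dyadicPoint_succ_two_pow a b n)

theorem dyadicMean_halvesConcat_right {a b : ℝ} (hab : a < b) (φ ψ : ℝ → ℝ) (n k : ℕ) :
    dyadicMean a b (halvesConcat a b φ ψ) (n + 1) (2 ^ n + k) = dyadicMean a b ψ n k := by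
  rw [dyadicMean, intervalMean_congr (dyadicPoint_lt_succ hab _ _).le
    (halvesConcat_eqOn_right φ ψ _ ?_), intervalMean_comp_two_mul_sub, add_assoc,
    two_mul_dyadicPoint_succ_sub_right, two_mul_dyadicPoint_succ_sub_right, dyadicMean]
  exact (dyadicPoint_succ_two_pow a b n).symm.trans_le
    (dyadicPoint_monotone hab _ (Nat.le_add_right _ _))

/-- Every proper dyadic subinterval lies in one half, where the pair of means is inherited from φ or
ψ. Only the root is new, and its pair of means is the midpoint x, which is assumed to be in the
domain. -/
theorem halvesConcat_mem_dyadicAdmissible {a b ε : ℝ} (hab : a < b) (hε : 0 ≤ ε)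
    {φ ψ : ℝ → ℝ} {x y z : ℝ × ℝ} (hx : x ∈ bellmanDomain ε) (h1 : x.1 = (y.1 + z.1) / 2)
    (h2 : x.2 = (y.2 + z.2) / 2) (hφ : φ ∈ dyadicAdmissible a b ε y)
    (hψ : ψ ∈ dyadicAdmissible a b ε z) :
    halvesConcat a b φ ψ ∈ dyadicAdmissible a b ε x := by
  rw [mem_dyadicAdmissible_iff hab hε] at *
  obtain ⟨p1, p2, p3, p4⟩ := hφ
  obtain ⟨q1, q2, q3, q4⟩ := hψ
  have i1 := intervalIntegrable_halvesConcat hab p1 q1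
  have i2 : IntervalIntegrable (fun t => halvesConcat a b φ ψ t ^ 2) volume a b := by
    rw [halvesConcat_sq]
    exact intervalIntegrable_halvesConcat hab p2 q2
  have hleft : ∀ n k, k < 2 ^ n → dyadicMeanPair a b (halvesConcat a b φ ψ) (n + 1) k =
      dyadicMeanPair a b φ n k := fun n k hk => by
    rw [dyadicMeanPair, halvesConcat_sq, dyadicMean_halvesConcat_left hab _ _ hk,
      dyadicMean_halvesConcat_left hab _ _ hk, dyadicMeanPair]
  have hright : ∀ n k, dyadicMeanPair a b (halvesConcat a b φ ψ) (n + 1) (2 ^ n + k) =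
      dyadicMeanPair a b ψ n k := fun n k => by
    rw [dyadicMeanPair, halvesConcat_sq, dyadicMean_halvesConcat_right hab,
      dyadicMean_halvesConcat_right hab, dyadicMeanPair]
  have hroot : dyadicMeanPair a b (halvesConcat a b φ ψ) 0 0 = x := by
    have l0 := hleft 0 0 (by simp)
    have r0 := hright 0 0
    rw [p4, dyadicMeanPair, Prod.ext_iff] at l0
    rw [q4, dyadicMeanPair, Prod.ext_iff] at r0
    have e1 := dyadicMean_eq_midpoint hab i1 (n := 0) (k := 0) (by simp)
    have e2 := dyadicMean_eq_midpoint hab i2 (n := 0) (k := 0) (by simp)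
    simp only [mul_zero, pow_zero, zero_add, add_zero] at e1 e2 l0 r0
    rw [l0.1, r0.1, ← h1] at e1
    rw [l0.2, r0.2, ← h2] at e2
    exact Prod.ext e1 e2
  refine ⟨i1, i2, fun n k hk => ?_, hroot⟩
  cases n with
  | zero =>
    obtain rfl : k = 0 := by simpa using hk
    rwa [hroot]
  | succ n =>
    rcases lt_or_ge k (2 ^ n) with h | h
    · rw [hleft n k h]
      exact p3 n k h
    · obtain ⟨j, rfl⟩ := Nat.exists_eq_add_of_le h
      rw [hright]
      refine q3 n j ?_
      rw [pow_succ] at hk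
      omega

theorem two_mul_lintegral_comp_two_mul_sub (g : ℝ → ℝ≥0∞) (d l u : ℝ) :
    2 * ∫⁻ t in Set.Ioc l u, g (2 * t - d) = ∫⁻ t in Set.Ioc (2 * l - d) (2 * u - d), g t := by
  have hd : ∀ t ∈ Set.Ioc l u, HasDerivWithinAt (fun t : ℝ => 2 * t + -d) 2 (Set.Ioc l u) t :=
    fun t _ => by
      simpa using (((hasDerivAt_id t).const_mul (2 : ℝ)).add_const (-d)).hasDerivWithinAt
  have h := lintegral_image_eq_lintegral_abs_deriv_mul measurableSet_Ioc hd
    (fun x _ y _ hxy => by simpa using hxy) g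
  rw [Set.image_affine_Ioc two_pos] at h
  simp only [← sub_eq_add_neg] at h
  rw [h, ← lintegral_const_mul' _ _ (by simp)]
  simp

theorem expAverage_halvesConcat {a b : ℝ} (hab : a < b) (φ ψ : ℝ → ℝ) :
    2 * expAverage a b (halvesConcat a b φ ψ) = expAverage a b φ + expAverage a b ψ := by
  have hm1 : a ≤ (a + b) / 2 := by linarith
  have hm2 : (a + b) / 2 ≤ b := by linarith
  have key : 2 * ∫⁻ s in Set.Ioc a b, ENNReal.ofReal (Real.exp (halvesConcat a b φ ψ s)) =
      (∫⁻ s in Set.Ioc a b, ENNReal.ofReal (Real.exp (φ s))) +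
      ∫⁻ s in Set.Ioc a b, ENNReal.ofReal (Real.exp (ψ s)) := by
    have e1 : ∫⁻ s in Set.Ioc a ((a + b) / 2),
        ENNReal.ofReal (Real.exp (halvesConcat a b φ ψ s)) =
        ∫⁻ s in Set.Ioc a ((a + b) / 2), ENNReal.ofReal (Real.exp (φ (2 * s - a))) :=
      setLIntegral_congr_fun measurableSet_Ioc fun s hs => by
        simp only [halvesConcat_eqOn_left φ ψ a le_rfl hs]
    have e2 : ∫⁻ s in Set.Ioc ((a + b) / 2) b,
        ENNReal.ofReal (Real.exp (halvesConcat a b φ ψ s)) =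
        ∫⁻ s in Set.Ioc ((a + b) / 2) b, ENNReal.ofReal (Real.exp (ψ (2 * s - b))) :=
      setLIntegral_congr_fun measurableSet_Ioc fun s hs => by
        simp only [halvesConcat_eqOn_right φ ψ b le_rfl hs]
    conv_lhs => rw [← Set.Ioc_union_Ioc_eq_Ioc hm1 hm2]
    rw [lintegral_union measurableSet_Ioc (Set.Ioc_disjoint_Ioc_of_le le_rfl), mul_add, e1, e2,
      two_mul_lintegral_comp_two_mul_sub fun s => ENNReal.ofReal (Real.exp (φ s)),
      two_mul_lintegral_comp_two_mul_sub fun s => ENNReal.ofReal (Real.exp (ψ s))]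
    congr 4 <;> ring
  simp only [expAverage, setLAverage_eq]
  rw [← mul_div_assoc, key, ENNReal.add_div]

/-- The function equal to x₁ + σ on the left half and x₁ - σ on the right half, with σ² = x₂ - x₁²,
is admissible. -/
theorem dyadicAdmissible_nonempty {a b ε : ℝ} (hab : a < b) (hε : 0 ≤ ε) {x : ℝ × ℝ}
    (hx : x ∈ bellmanDomain ε) : (dyadicAdmissible a b ε x).Nonempty := by
  have hs := Real.sq_sqrt (sub_nonneg.2 hx.1)
  set σ := √(x.2 - x.1 ^ 2)
  exact ⟨_, halvesConcat_mem_dyadicAdmissible hab hε hx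
    (y := (x.1 + σ, (x.1 + σ) ^ 2)) (z := (x.1 - σ, (x.1 - σ) ^ 2)) (by simp)
    (by simp only; linarith)
    (const_mem_dyadicAdmissible hab hε rfl) (const_mem_dyadicAdmissible hab hε rfl)⟩

theorem add_le_two_mul_upperDyadicBellman {a b ε : ℝ} (hab : a < b) (hε : 0 ≤ ε)
    {x y z : ℝ × ℝ} (hx : x ∈ bellmanDomain ε) (hy : y ∈ bellmanDomain ε)
    (hz : z ∈ bellmanDomain ε) (h1 : x.1 = (y.1 + z.1) / 2) (h2 : x.2 = (y.2 + z.2) / 2) :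
    upperDyadicBellman a b ε y + upperDyadicBellman a b ε z ≤
      2 * upperDyadicBellman a b ε x := by
  refine ENNReal.biSup_add_biSup_le (dyadicAdmissible_nonempty hab hε hy)
    (dyadicAdmissible_nonempty hab hε hz) fun φ hφ ψ hψ => ?_
  rw [← expAverage_halvesConcat hab]
  gcongr
  exact le_iSup₂ (f := fun φ (_ : φ ∈ dyadicAdmissible a b ε x) => expAverage a b φ) _
    (halvesConcat_mem_dyadicAdmissible hab hε hx h1 h2 hφ hψ)

theorem two_mul_lowerDyadicBellman_le {a b ε : ℝ} (hab : a < b) (hε : 0 ≤ ε)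
    {x y z : ℝ × ℝ} (hx : x ∈ bellmanDomain ε) (h1 : x.1 = (y.1 + z.1) / 2)
    (h2 : x.2 = (y.2 + z.2) / 2) :
    2 * lowerDyadicBellman a b ε x ≤
      lowerDyadicBellman a b ε y + lowerDyadicBellman a b ε z := by
  refine ENNReal.le_iInf₂_add_iInf₂ fun φ hφ ψ hψ => ?_
  rw [← expAverage_halvesConcat hab]
  gcongr
  exact iInf₂_le (f := fun φ (_ : φ ∈ dyadicAdmissible a b ε x) => expAverage a b φ) _
    (halvesConcat_mem_dyadicAdmissible hab hε hx h1 h2 hφ hψ)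

/-! ### Shifts by constants -/

theorem intervalMean_add_const {f : ℝ → ℝ} {l u : ℝ} (hlu : l < u)
    (hf : IntervalIntegrable f volume l u) (v : ℝ) :
    intervalMean (fun t => f t + v) l u = intervalMean f l u + v := by
  have : u - l ≠ 0 := by linarith
  rw [intervalMean, intervalIntegral.integral_add hf intervalIntegrable_const,
    intervalIntegral.integral_const, intervalMean, smul_eq_mul]
  field_simp

theorem intervalMean_const_mul (f : ℝ → ℝ) (l u v : ℝ) :
    intervalMean (fun t => v * f t) l u = v * intervalMean f l u := by
  simp [intervalMean, mul_div_assoc]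

theorem intervalMean_add {f g : ℝ → ℝ} {l u : ℝ} (hf : IntervalIntegrable f volume l u)
    (hg : IntervalIntegrable g volume l u) :
    intervalMean (fun t => f t + g t) l u = intervalMean f l u + intervalMean g l u := by
  rw [intervalMean, intervalIntegral.integral_add hf hg, intervalMean, intervalMean, add_div]

theorem add_const_mem_dyadicAdmissible {a b ε : ℝ} (hab : a < b) (hε : 0 ≤ ε) {φ : ℝ → ℝ}
    {x : ℝ × ℝ} (hφ : φ ∈ dyadicAdmissible a b ε x) (v : ℝ) :
    (fun t => φ t + v) ∈ dyadicAdmissible a b ε (x.1 + v, x.2 + 2 * v * x.1 + v ^ 2) := by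
  rw [mem_dyadicAdmissible_iff hab hε] at *
  obtain ⟨h1, h2, h3, h4⟩ := hφ
  have e : (fun t => (φ t + v) ^ 2) = fun t => φ t ^ 2 + 2 * v * φ t + v ^ 2 := by
    funext t; ring
  have hpair : ∀ n k, k < 2 ^ n → dyadicMeanPair a b (fun t => φ t + v) n k =
      ((dyadicMeanPair a b φ n k).1 + v, (dyadicMeanPair a b φ n k).2
        + 2 * v * (dyadicMeanPair a b φ n k).1 + v ^ 2) := fun n k hk => by
    have hs := uIcc_dyadicPoint_subset hab hk
    have hlt := dyadicPoint_lt_succ hab n k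
    have i1 := h1.mono_set hs
    have i2 := h2.mono_set hs
    simp only [dyadicMeanPair, dyadicMean]
    rw [e, intervalMean_add_const hlt i1, intervalMean_add_const hlt (i2.add (i1.const_mul _)),
      intervalMean_add i2 (i1.const_mul _), intervalMean_const_mul]
  refine ⟨h1.add intervalIntegrable_const, ?_, fun n k hk => ?_, ?_⟩
  · rw [e]
    exact (h2.add (h1.const_mul _)).add intervalIntegrable_const
  · rw [hpair n k hk]
    have := h3 n k hk
    exact ⟨by simp only; linarith [this.1], by simp only; linarith [this.2]⟩
  · rw [hpair 0 0 (by simp), h4]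

theorem expAverage_add_const (a b : ℝ) (φ : ℝ → ℝ) (v : ℝ) :
    expAverage a b (fun t => φ t + v) = ENNReal.ofReal (Real.exp v) * expAverage a b φ := by
  simp only [expAverage, laverage_eq]
  rw [← mul_div_assoc, ← lintegral_const_mul' _ _ ENNReal.ofReal_ne_top]
  congr 2
  funext t
  rw [← ENNReal.ofReal_mul (Real.exp_pos _).le, ← Real.exp_add, add_comm]

theorem ofReal_exp_mul_upperDyadicBellman_le {a b ε : ℝ} (hab : a < b) (hε : 0 ≤ ε) (v : ℝ)
    (x : ℝ × ℝ) : ENNReal.ofReal (Real.exp v) * upperDyadicBellman a b ε x ≤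
      upperDyadicBellman a b ε (x.1 + v, x.2 + 2 * v * x.1 + v ^ 2) := by
  unfold upperDyadicBellman
  simp only [ENNReal.mul_iSup]
  refine iSup₂_le fun φ hφ => ?_
  rw [← expAverage_add_const]
  exact le_iSup₂ (f := fun φ (_ : φ ∈ dyadicAdmissible a b ε _) => expAverage a b φ) _
    (add_const_mem_dyadicAdmissible hab hε hφ v)

theorem lowerDyadicBellman_le_ofReal_exp_mul {a b ε : ℝ} (hab : a < b) (hε : 0 ≤ ε) (v : ℝ)
    (x : ℝ × ℝ) : lowerDyadicBellman a b ε (x.1 + v, x.2 + 2 * v * x.1 + v ^ 2) ≤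
      ENNReal.ofReal (Real.exp v) * lowerDyadicBellman a b ε x := by
  have h0 : ENNReal.ofReal (Real.exp v) ≠ 0 := by simp [Real.exp_pos]
  rw [← ENNReal.inv_mul_le_iff h0 ENNReal.ofReal_ne_top]
  refine le_iInf₂ fun φ hφ => ?_
  rw [ENNReal.inv_mul_le_iff h0 ENNReal.ofReal_ne_top, ← expAverage_add_const]
  exact iInf₂_le (f := fun φ (_ : φ ∈ dyadicAdmissible a b ε _) => expAverage a b φ) _
    (add_const_mem_dyadicAdmissible hab hε hφ v)

/-! ### From midpoints to chords -/

/-- A midpoint concave function on `[0, 1]` lies above its chord. -/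
theorem ofReal_chord_le_of_midpoint {f : ℝ → ℝ≥0∞} (hf : ∀ s ∈ Set.Icc (0 : ℝ) 1,
    ∀ t ∈ Set.Icc (0 : ℝ) 1, f s + f t ≤ 2 * f ((s + t) / 2)) {α β : ℝ}
    (hα : ENNReal.ofReal α ≤ f 0) (hβ : ENNReal.ofReal β ≤ f 1) {τ : ℝ}
    (hτ : τ ∈ Set.Icc (0 : ℝ) 1) : ENNReal.ofReal ((1 - τ) * α + τ * β) ≤ f τ := by
  -- Each τ is the midpoint of an end of [0, 1] and another point, and the error at the end is zero,
  -- so one step halves the error. Nonnegativity of f gives the start; no continuity is used.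
  have key : ∀ n : ℕ, ∀ τ ∈ Set.Icc (0 : ℝ) 1,
      ENNReal.ofReal ((1 - τ) * α + τ * β - (|α| + |β|) / 2 ^ n) ≤ f τ := by
    intro n
    induction n with
    | zero =>
      intro τ hτ
      rw [ENNReal.ofReal_of_nonpos]
      · exact zero_le
      · nlinarith [hτ.1, hτ.2, le_abs_self α, le_abs_self β, abs_nonneg α, abs_nonneg β]
    | succ n ih =>
      intro τ hτ
      have h2 : (2 : ℝ≥0∞) = ENNReal.ofReal 2 := by simp
      rw [← ENNReal.mul_le_mul_iff_right two_ne_zero ENNReal.ofNat_ne_top, h2,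
        ← ENNReal.ofReal_mul zero_le_two, ← h2]
      rcases le_total τ (1 / 2) with h | h
      · have hm : 2 * τ ∈ Set.Icc (0 : ℝ) 1 := ⟨by linarith [hτ.1], by linarith⟩
        have h3 := hf 0 (by simp) (2 * τ) hm
        rw [show (0 + 2 * τ) / 2 = τ by ring] at h3
        refine le_trans ?_ ((add_le_add hα (ih _ hm)).trans h3)
        refine (ENNReal.ofReal_le_ofReal (le_of_eq ?_)).trans ENNReal.ofReal_add_le
        rw [pow_succ]; field_simp; ring
      · have hm : 2 * τ - 1 ∈ Set.Icc (0 : ℝ) 1 := ⟨by linarith, by linarith [hτ.2]⟩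
        have h3 := hf 1 (by simp) (2 * τ - 1) hm
        rw [show (1 + (2 * τ - 1)) / 2 = τ by ring] at h3
        refine le_trans ?_ ((add_le_add hβ (ih _ hm)).trans h3)
        refine (ENNReal.ofReal_le_ofReal (le_of_eq ?_)).trans ENNReal.ofReal_add_le
        rw [pow_succ]; field_simp; ring
  have hlim : Filter.Tendsto
      (fun n : ℕ => (1 - τ) * α + τ * β - (|α| + |β|) / 2 ^ n) Filter.atTop
      (nhds ((1 - τ) * α + τ * β - 0)) :=
    (tendsto_const_nhds.div_atTop (tendsto_pow_atTop_atTop_of_one_lt one_lt_two)).const_sub _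
  rw [sub_zero] at hlim
  exact le_of_tendsto (ENNReal.tendsto_ofReal hlim) (Filter.Eventually.of_forall fun n => key n τ hτ)

/-- A bounded midpoint convex function on `[0, 1]` lies below its chord. -/
theorem le_ofReal_chord_of_midpoint {f : ℝ → ℝ≥0∞} (hf : ∀ s ∈ Set.Icc (0 : ℝ) 1,
    ∀ t ∈ Set.Icc (0 : ℝ) 1, 2 * f ((s + t) / 2) ≤ f s + f t) {α β M : ℝ} (hα0 : 0 ≤ α)
    (hβ0 : 0 ≤ β) (hM0 : 0 ≤ M) (hM : ∀ s ∈ Set.Icc (0 : ℝ) 1, f s ≤ ENNReal.ofReal M)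
    (hα : f 0 ≤ ENNReal.ofReal α) (hβ : f 1 ≤ ENNReal.ofReal β) {τ : ℝ}
    (hτ : τ ∈ Set.Icc (0 : ℝ) 1) : f τ ≤ ENNReal.ofReal ((1 - τ) * α + τ * β) := by
  have hpos : ∀ τ ∈ Set.Icc (0 : ℝ) 1, 0 ≤ (1 - τ) * α + τ * β := fun τ hτ =>
    add_nonneg (mul_nonneg (sub_nonneg.2 hτ.2) hα0) (mul_nonneg hτ.1 hβ0)
  have key : ∀ n : ℕ, ∀ τ ∈ Set.Icc (0 : ℝ) 1,
      f τ ≤ ENNReal.ofReal ((1 - τ) * α + τ * β + M / 2 ^ n) := by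
    intro n
    induction n with
    | zero =>
      intro τ hτ
      exact (hM τ hτ).trans (ENNReal.ofReal_le_ofReal (by simpa using hpos τ hτ))
    | succ n ih =>
      intro τ hτ
      have h2 : (2 : ℝ≥0∞) = ENNReal.ofReal 2 := by simp
      rw [← ENNReal.mul_le_mul_iff_right two_ne_zero ENNReal.ofNat_ne_top, h2,
        ← ENNReal.ofReal_mul zero_le_two, ← h2]
      rcases le_total τ (1 / 2) with h | h
      · have hm : 2 * τ ∈ Set.Icc (0 : ℝ) 1 := ⟨by linarith [hτ.1], by linarith⟩
        have h3 := hf 0 (by simp) (2 * τ) hm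
        rw [show (0 + 2 * τ) / 2 = τ by ring] at h3
        refine (h3.trans (add_le_add hα (ih _ hm))).trans ?_
        rw [← ENNReal.ofReal_add hα0 (add_nonneg (hpos _ hm) (by positivity))]
        refine ENNReal.ofReal_le_ofReal (le_of_eq ?_)
        rw [pow_succ]; field_simp; ring
      · have hm : 2 * τ - 1 ∈ Set.Icc (0 : ℝ) 1 := ⟨by linarith, by linarith [hτ.2]⟩
        have h3 := hf 1 (by simp) (2 * τ - 1) hm
        rw [show (1 + (2 * τ - 1)) / 2 = τ by ring] at h3
        refine (h3.trans (add_le_add hβ (ih _ hm))).trans ?_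
        rw [← ENNReal.ofReal_add hβ0 (add_nonneg (hpos _ hm) (by positivity))]
        refine ENNReal.ofReal_le_ofReal (le_of_eq ?_)
        rw [pow_succ]; field_simp; ring
  have hlim : Filter.Tendsto
      (fun n : ℕ => (1 - τ) * α + τ * β + M / 2 ^ n) Filter.atTop
      (nhds ((1 - τ) * α + τ * β + 0)) :=
    (tendsto_const_nhds.div_atTop (tendsto_pow_atTop_atTop_of_one_lt one_lt_two)).const_add _
  rw [add_zero] at hlim
  exact ge_of_tendsto (ENNReal.tendsto_ofReal hlim) (Filter.Eventually.of_forall fun n => key n τ hτ)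

/-- The point that divides the segment from `P` to `Q` in the ratio `t : 1 - t`. -/
def segmentPoint (P Q : ℝ × ℝ) (t : ℝ) : ℝ × ℝ :=
  ((1 - t) * P.1 + t * Q.1, (1 - t) * P.2 + t * Q.2)

theorem segmentPoint_zero (P Q : ℝ × ℝ) : segmentPoint P Q 0 = P := by simp [segmentPoint]

theorem segmentPoint_one (P Q : ℝ × ℝ) : segmentPoint P Q 1 = Q := by simp [segmentPoint]

theorem ofReal_chord_le_upperDyadicBellman {a b ε : ℝ} (hab : a < b) (hε : 0 ≤ ε) {P Q : ℝ × ℝ}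
    (hPQ : ∀ t ∈ Set.Icc (0 : ℝ) 1, segmentPoint P Q t ∈ bellmanDomain ε) {α β τ : ℝ}
    (hα : ENNReal.ofReal α ≤ upperDyadicBellman a b ε P)
    (hβ : ENNReal.ofReal β ≤ upperDyadicBellman a b ε Q) (hτ : τ ∈ Set.Icc (0 : ℝ) 1) :
    ENNReal.ofReal ((1 - τ) * α + τ * β) ≤ upperDyadicBellman a b ε (segmentPoint P Q τ) := by
  refine ofReal_chord_le_of_midpoint (f := fun t => upperDyadicBellman a b ε (segmentPoint P Q t))
    (fun s hs t ht => ?_) (by rwa [segmentPoint_zero]) (by rwa [segmentPoint_one]) hτ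
  refine add_le_two_mul_upperDyadicBellman hab hε (hPQ _ ⟨?_, ?_⟩) (hPQ s hs) (hPQ t ht) ?_ ?_
  · linarith [hs.1, ht.1]
  · linarith [hs.2, ht.2]
  · simp only [segmentPoint]; ring
  · simp only [segmentPoint]; ring

/-- The midpoint inequality with the lower-boundary points over x₁ ± σ, where σ ≤ ε. It supplies the
boundedness that passing from midpoint convexity to chords requires. -/
theorem lowerDyadicBellman_le_ofReal_exp {a b ε : ℝ} (hab : a < b) (hε : 0 ≤ ε) {x : ℝ × ℝ}
    (hx : x ∈ bellmanDomain ε) :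
    lowerDyadicBellman a b ε x ≤ ENNReal.ofReal (Real.exp (|x.1| + ε)) := by
  have hs := Real.sq_sqrt (sub_nonneg.2 hx.1)
  have hs0 := Real.sqrt_nonneg (x.2 - x.1 ^ 2)
  have hsε : √(x.2 - x.1 ^ 2) ≤ ε := by
    rw [Real.sqrt_le_left hε]; linarith [hx.2]
  set σ := √(x.2 - x.1 ^ 2)
  have h := two_mul_lowerDyadicBellman_le hab hε hx
    (y := (x.1 + σ, (x.1 + σ) ^ 2)) (z := (x.1 - σ, (x.1 - σ) ^ 2)) (by simp)
    (by simp only; linarith)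
  rw [lowerDyadicBellman_of_eq_sq hab hε (x := (x.1 + σ, (x.1 + σ) ^ 2)) rfl,
    lowerDyadicBellman_of_eq_sq hab hε (x := (x.1 - σ, (x.1 - σ) ^ 2)) rfl] at h
  rw [← ENNReal.mul_le_mul_iff_right two_ne_zero ENNReal.ofNat_ne_top, two_mul (ENNReal.ofReal _)]
  refine h.trans (add_le_add ?_ ?_) <;>
  · refine ENNReal.ofReal_le_ofReal (Real.exp_le_exp.2 ?_)
    simp only
    linarith [le_abs_self x.1]

theorem lowerDyadicBellman_le_ofReal_chord {a b ε : ℝ} (hab : a < b) (hε : 0 ≤ ε) {P Q : ℝ × ℝ}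
    (hPQ : ∀ t ∈ Set.Icc (0 : ℝ) 1, segmentPoint P Q t ∈ bellmanDomain ε) {α β τ : ℝ}
    (hα0 : 0 ≤ α) (hβ0 : 0 ≤ β)
    (hα : lowerDyadicBellman a b ε P ≤ ENNReal.ofReal α)
    (hβ : lowerDyadicBellman a b ε Q ≤ ENNReal.ofReal β) (hτ : τ ∈ Set.Icc (0 : ℝ) 1) :
    lowerDyadicBellman a b ε (segmentPoint P Q τ) ≤ ENNReal.ofReal ((1 - τ) * α + τ * β) := by
  refine le_ofReal_chord_of_midpoint (f := fun t => lowerDyadicBellman a b ε (segmentPoint P Q t))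
    (M := Real.exp (|P.1| + |Q.1| + ε)) (fun s hs t ht => ?_) hα0 hβ0 (Real.exp_pos _).le
    (fun t ht => ?_) (by rwa [segmentPoint_zero]) (by rwa [segmentPoint_one]) hτ
  · refine two_mul_lowerDyadicBellman_le hab hε (hPQ _ ⟨?_, ?_⟩) ?_ ?_
    · linarith [hs.1, ht.1]
    · linarith [hs.2, ht.2]
    · simp only [segmentPoint]; ring
    · simp only [segmentPoint]; ring
  · refine (lowerDyadicBellman_le_ofReal_exp hab hε (hPQ t ht)).trans
      (ENNReal.ofReal_le_ofReal (Real.exp_le_exp.2 (add_le_add ?_ le_rfl)))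
    refine (abs_add_le _ _).trans ?_
    rw [abs_mul, abs_mul, abs_of_nonneg ht.1, abs_of_nonneg (sub_nonneg.2 ht.2)]
    nlinarith [abs_nonneg P.1, abs_nonneg Q.1, ht.1, ht.2]

/-! ### Affine segments and values on the upper boundary -/

/-- Every point of the domain lies on a segment from the lower to the upper boundary along which
the candidate is affine. -/
theorem exists_bellmanCandidate_eq_chord {κ δ ε : ℝ} (hκ : κ ^ 2 = 1) (hε : 0 < ε) (hδ : ε < δ)
    {x : ℝ × ℝ} (hx : x ∈ bellmanDomain ε) :
    ∃ P Q : ℝ × ℝ, ∃ τ ∈ Set.Icc (0 : ℝ) 1, P.2 = P.1 ^ 2 ∧ Q.2 = Q.1 ^ 2 + ε ^ 2 ∧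
      (∀ t ∈ Set.Icc (0 : ℝ) 1, segmentPoint P Q t ∈ bellmanDomain ε) ∧
      x = segmentPoint P Q τ ∧ bellmanCandidate κ δ x =
        (1 - τ) * bellmanCandidate κ δ P + τ * bellmanCandidate κ δ Q := by
  have hδ0 : 0 < δ := hε.trans hδ
  have hlt : ε ^ 2 < δ ^ 2 := by nlinarith
  have hs2 := Real.sq_sqrt (sub_pos.2 hlt).le
  have hs0 := Real.sqrt_nonneg (δ ^ 2 - ε ^ 2)
  have hr2 : √(δ ^ 2 + x.1 ^ 2 - x.2) ^ 2 = δ ^ 2 + x.1 ^ 2 - x.2 :=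
    Real.sq_sqrt (by linarith [hx.2])
  have hr0 := Real.sqrt_nonneg (δ ^ 2 + x.1 ^ 2 - x.2)
  have hrδ := sqrt_sub_le_of_mem_bellmanDomain hδ0.le hx
  have hsr : √(δ ^ 2 - ε ^ 2) ≤ √(δ ^ 2 + x.1 ^ 2 - x.2) :=
    Real.sqrt_le_sqrt (by linarith [hx.2])
  have hsδ : √(δ ^ 2 - ε ^ 2) < δ := by
    rw [Real.sqrt_lt' hδ0]; linarith [sq_pos_of_pos hε]
  set s := √(δ ^ 2 - ε ^ 2)
  set r := √(δ ^ 2 + x.1 ^ 2 - x.2) with hr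
  -- The line touches the parabola x₂ = x₁² + δ² at abscissa c. On it ρ measures the horizontal
  -- distance to the point of tangency, with ρ = δ on the lower and ρ = s on the upper boundary of
  -- the domain.
  set c := x.1 + κ * r with hc
  set L : ℝ → ℝ × ℝ := fun ρ => (c - κ * ρ, c ^ 2 - 2 * κ * c * ρ + δ ^ 2) with hL
  have hLy : ∀ ρ, (L ρ).2 - (L ρ).1 ^ 2 = δ ^ 2 - ρ ^ 2 := fun ρ => by
    simp only [hL]; linear_combination -ρ ^ 2 * hκ
  have hLx : L r = x := by
    refine Prod.ext (by simp only [hL, hc]; ring) ?_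
    have := hLy r
    have h1 : (L r).1 = x.1 := by simp only [hL, hc]; ring
    rw [h1] at this
    linarith
  have hseg : ∀ t, segmentPoint (L δ) (L s) t = L ((1 - t) * δ + t * s) := fun t => by
    simp only [segmentPoint, hL]
    refine Prod.ext ?_ ?_ <;> simp only <;> ring
  have hcand : ∀ ρ, 0 ≤ ρ → bellmanCandidate κ δ (L ρ) =
      Real.exp c * (1 - κ * ρ) / bellmanProfile κ δ := fun ρ hρ => by
    rw [bellmanCandidate, show δ ^ 2 + (L ρ).1 ^ 2 - (L ρ).2 = ρ ^ 2 by linarith [hLy ρ],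
      Real.sqrt_sq hρ]
    have : Real.exp c = Real.exp (L ρ).1 * Real.exp (κ * ρ) := by
      rw [← Real.exp_add]; simp [hL]
    rw [this, bellmanProfile]
    ring
  have hτ : (1 - (δ - r) / (δ - s)) * δ + (δ - r) / (δ - s) * s = r := by
    have : δ - s ≠ 0 := by linarith
    field_simp
    ring
  refine ⟨L δ, L s, (δ - r) / (δ - s), ⟨?_, ?_⟩, ?_, ?_, fun t ht => ?_, ?_, ?_⟩
  · exact div_nonneg (by linarith) (by linarith)
  · rw [div_le_one (by linarith)]; linarith
  · linarith [hLy δ]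
  · linarith [hLy s]
  · rw [hseg]
    have h1 : s ≤ (1 - t) * δ + t * s := by nlinarith [ht.1, ht.2]
    have h2 : (1 - t) * δ + t * s ≤ δ := by nlinarith [ht.1, ht.2]
    have := hLy ((1 - t) * δ + t * s)
    exact ⟨by nlinarith, by nlinarith⟩
  · rw [hseg, hτ, hLx]
  · rw [hcand δ hδ0.le, hcand s hs0, ← hLx, hcand r hr0]
    linear_combination (-(Real.exp c * κ / bellmanProfile κ δ)) * (-hτ)

theorem two_mul_div_sqrt_two_sq (ε : ℝ) : 2 * (ε / √2) ^ 2 = ε ^ 2 := by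
  rw [div_pow, Real.sq_sqrt (by norm_num)]; ring

theorem mem_bellmanDomain_of_eq_top {ε : ℝ} {x : ℝ × ℝ} (hx : x.2 = x.1 ^ 2 + ε ^ 2) :
    x ∈ bellmanDomain ε := ⟨by linarith [sq_nonneg ε], hx.le⟩

theorem mem_bellmanDomain_of_eq_sq {ε : ℝ} {x : ℝ × ℝ} (hx : x.2 = x.1 ^ 2) :
    x ∈ bellmanDomain ε := ⟨hx.ge, by linarith [sq_nonneg ε]⟩

/-- With v = ε/√2, the point (0, ε²) is the midpoint of (v, v² + ε²) and (-v, v²). The first is a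
shift of (0, ε²) itself and the second lies on the lower boundary. -/
theorem upperDyadicBellman_top_self_improve {a b ε : ℝ} (hab : a < b) (hε : 0 ≤ ε) :
    ENNReal.ofReal (Real.exp (ε / √2)) * upperDyadicBellman a b ε (0, ε ^ 2) +
      ENNReal.ofReal (Real.exp (-(ε / √2))) ≤ 2 * upperDyadicBellman a b ε (0, ε ^ 2) := by
  have h2 := two_mul_div_sqrt_two_sq ε
  set v := ε / √2
  have h1 := ofReal_exp_mul_upperDyadicBellman_le hab hε v (0, ε ^ 2)
  have h3 := upperDyadicBellman_of_eq_sq (x := (-v, (-v) ^ 2)) hab hε rfl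
  rw [← h3]
  refine (add_le_add_left h1 _).trans ?_
  refine add_le_two_mul_upperDyadicBellman hab hε (mem_bellmanDomain_of_eq_top (by simp))
    (mem_bellmanDomain_of_eq_top ?_) (mem_bellmanDomain_of_eq_sq rfl) ?_ ?_ <;> simp only <;> linarith

theorem lowerDyadicBellman_top_self_improve {a b ε : ℝ} (hab : a < b) (hε : 0 ≤ ε) :
    2 * lowerDyadicBellman a b ε (0, ε ^ 2) ≤
      ENNReal.ofReal (Real.exp (-(ε / √2))) * lowerDyadicBellman a b ε (0, ε ^ 2) +
      ENNReal.ofReal (Real.exp (ε / √2)) := by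
  have h2 := two_mul_div_sqrt_two_sq ε
  set v := ε / √2
  have h1 := lowerDyadicBellman_le_ofReal_exp_mul hab hε (-v) (0, ε ^ 2)
  have h3 := lowerDyadicBellman_of_eq_sq (x := (v, v ^ 2)) hab hε rfl
  rw [← h3]
  refine le_trans ?_ (add_le_add_left h1 _)
  refine two_mul_lowerDyadicBellman_le hab hε (mem_bellmanDomain_of_eq_top (by simp)) ?_ ?_ <;>
    simp only <;> linarith

theorem upperDyadicBellman_top_ge {a b ε c : ℝ} (hab : a < b) (hε : 0 ≤ ε)
    (hc : ENNReal.ofReal c ≤ upperDyadicBellman a b ε (0, ε ^ 2)) {x : ℝ × ℝ}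
    (hx : x.2 = x.1 ^ 2 + ε ^ 2) :
    ENNReal.ofReal (Real.exp x.1 * c) ≤ upperDyadicBellman a b ε x := by
  have h1 := ofReal_exp_mul_upperDyadicBellman_le hab hε x.1 (0, ε ^ 2)
  rw [show ((0, ε ^ 2) : ℝ × ℝ).1 + x.1 = x.1 by simp, show ((0, ε ^ 2) : ℝ × ℝ).2 +
    2 * x.1 * ((0, ε ^ 2) : ℝ × ℝ).1 + x.1 ^ 2 = x.2 by simp only; linarith] at h1
  rw [ENNReal.ofReal_mul (Real.exp_pos _).le]
  exact (mul_le_mul_right hc _).trans h1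

/-- Once e^{ε/√2} ≥ 2, no finite T ≥ 0 satisfies e^{ε/√2}T + e^{-ε/√2} ≤ 2T. -/
theorem upperDyadicBellman_top_eq_top {a b ε : ℝ} (hab : a < b) (hε : √2 * Real.log 2 ≤ ε) :
    upperDyadicBellman a b ε (0, ε ^ 2) = ⊤ := by
  have hε0 : 0 ≤ ε := le_trans (mul_nonneg (Real.sqrt_nonneg _) (Real.log_nonneg (by norm_num))) hε
  by_contra hne
  have h := upperDyadicBellman_top_self_improve hab hε0
  lift upperDyadicBellman a b ε (0, ε ^ 2) to NNReal using hne with c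
  have h2 : 2 ≤ Real.exp (ε / √2) := by
    rw [← Real.log_le_iff_le_exp two_pos, le_div_iff₀ (by positivity), mul_comm]
    exact hε
  have hreal : Real.exp (ε / √2) * c + Real.exp (-(ε / √2)) ≤ 2 * c := by
    have := ENNReal.toReal_mono (by finiteness) h
    rwa [ENNReal.toReal_add (by finiteness) (by finiteness), ENNReal.toReal_mul,
      ENNReal.toReal_mul, ENNReal.toReal_ofReal (Real.exp_pos _).le,
      ENNReal.toReal_ofReal (Real.exp_pos _).le] at this
  nlinarith [Real.exp_pos (-(ε / √2)), c.coe_nonneg]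

theorem upperDyadicBellman_eq_top {a b ε : ℝ} (hab : a < b) (hε : √2 * Real.log 2 ≤ ε)
    {x : ℝ × ℝ} (hx : x ∈ bellmanDomain ε) (hlt : x.1 ^ 2 < x.2) :
    upperDyadicBellman a b ε x = ⊤ := by
  have hε0 : 0 < ε :=
    lt_of_lt_of_le (mul_pos (Real.sqrt_pos.2 two_pos) (Real.log_pos (by norm_num))) hε
  have hsq : 0 < ε ^ 2 := by positivity
  set τ := (x.2 - x.1 ^ 2) / ε ^ 2 with hτ
  have hτ0 : 0 < τ := div_pos (by linarith) hsq
  have hτ1 : τ ≤ 1 := by rw [hτ, div_le_one hsq]; linarith [hx.2]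
  have hxs : segmentPoint (x.1, x.1 ^ 2) (x.1, x.1 ^ 2 + ε ^ 2) τ = x := by
    refine Prod.ext (by simp only [segmentPoint]; ring) ?_
    simp only [segmentPoint, hτ]
    field_simp
    ring
  refine ENNReal.eq_top_of_forall_nnreal_le fun r => ?_
  -- On the vertical segment through x the upper end has value ∞, so β may be any real number; it is
  -- chosen to make τβ = r.
  have h := ofReal_chord_le_upperDyadicBellman (P := (x.1, x.1 ^ 2)) (Q := (x.1, x.1 ^ 2 + ε ^ 2))
    (α := 0) (β := Real.exp x.1 * (r / (Real.exp x.1 * τ))) (τ := τ) hab hε0.le (fun t ht => ?_)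
    (by simp)
    (upperDyadicBellman_top_ge hab hε0.le
      (by rw [upperDyadicBellman_top_eq_top hab hε]; exact le_top) rfl) ⟨hτ0.le, hτ1⟩
  · rw [hxs, show (1 - τ) * 0 + τ * (Real.exp x.1 * (r / (Real.exp x.1 * τ))) = r by
      field_simp; ring, ENNReal.ofReal_coe_nnreal] at h
    exact h
  · simp only [segmentPoint, bellmanDomain, Set.mem_ofPred_eq]
    constructor <;> nlinarith [ht.1, ht.2]

theorem bellmanCandidate_of_eq_top {κ δ ε : ℝ} {x : ℝ × ℝ} (hx : x.2 = x.1 ^ 2 + ε ^ 2) :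
    bellmanCandidate κ δ x =
      Real.exp x.1 * (bellmanProfile κ √(δ ^ 2 - ε ^ 2) / bellmanProfile κ δ) := by
  rw [bellmanCandidate, hx, mul_div_assoc,
    show δ ^ 2 + x.1 ^ 2 - (x.1 ^ 2 + ε ^ 2) = δ ^ 2 - ε ^ 2 by ring]

theorem upperDyadicBellman_eq {a b ε δ : ℝ} (hab : a < b) (hε : 0 < ε) (hδ : ε < δ) (hδ1 : δ < 1)
    (heq : DeltaPlusEq ε δ) {x : ℝ × ℝ} (hx : x ∈ bellmanDomain ε) :
    upperDyadicBellman a b ε x = ENNReal.ofReal (Bplus δ x) := by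
  rw [deltaPlusEq_iff] at heq
  rw [Bplus_eq_bellmanCandidate]
  have hδ0 : 0 < δ := hε.trans hδ
  have hpos : 0 < bellmanProfile 1 δ := mul_pos (by linarith) (Real.exp_pos _)
  refine le_antisymm
    (iSup₂_le fun φ hφ => expAverage_le_bellmanCandidate hab hε hδ hpos heq hφ) ?_
  -- The right side of the equation for δ and the profile on its left are positive, so the remaining
  -- factor is too.
  have hgap : 0 < 2 - Real.exp (ε / √2) := by
    have h1 : bellmanProfile 1 δ ≤ bellmanProfile 1 √(δ ^ 2 - ε ^ 2) :=
      bellmanProfile_antitoneOn 1 (Set.mem_Ici.2 (Real.sqrt_nonneg _)) (Set.mem_Ici.2 hδ0.le)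
        ((Real.sqrt_le_left hδ0.le).2 (by linarith [sq_nonneg ε]))
    have h2 : 0 < bellmanProfile 1 δ * Real.exp (-(1 * (ε / √2))) := mul_pos hpos (Real.exp_pos _)
    rw [← heq, one_mul] at h2
    exact pos_of_mul_pos_right h2 (hpos.trans_le h1).le
  have htop : ENNReal.ofReal (bellmanProfile 1 √(δ ^ 2 - ε ^ 2) / bellmanProfile 1 δ) ≤
      upperDyadicBellman a b ε (0, ε ^ 2) := by
    by_cases hne : upperDyadicBellman a b ε (0, ε ^ 2) = ⊤
    · rw [hne]; exact le_top
    have h := upperDyadicBellman_top_self_improve hab hε.le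
    lift upperDyadicBellman a b ε (0, ε ^ 2) to NNReal using hne with c
    have hreal : Real.exp (ε / √2) * c + Real.exp (-(ε / √2)) ≤ 2 * c := by
      have := ENNReal.toReal_mono (by finiteness) h
      rwa [ENNReal.toReal_add (by finiteness) (by finiteness), ENNReal.toReal_mul,
        ENNReal.toReal_mul, ENNReal.toReal_ofReal (Real.exp_pos _).le,
        ENNReal.toReal_ofReal (Real.exp_pos _).le] at this
    rw [← ENNReal.ofReal_coe_nnreal]
    refine ENNReal.ofReal_le_ofReal ?_
    rw [div_le_iff₀ hpos]
    rw [one_mul] at heq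
    refine le_of_mul_le_mul_right ?_ hgap
    rw [heq]
    -- The bound for c at (0, ε²) reads e^{-ε/√2} ≤ c(2 - e^{ε/√2}), and the equation says that the
    -- candidate's value attains equality.
    nlinarith
  obtain ⟨P, Q, τ, hτ, hP, hQ, hseg, hxs, hval⟩ :=
    exists_bellmanCandidate_eq_chord (κ := 1) (one_pow 2) hε hδ hx
  rw [hval]
  conv_rhs => rw [hxs]
  refine ofReal_chord_le_upperDyadicBellman hab hε.le hseg ?_ ?_ hτ
  · rw [upperDyadicBellman_of_eq_sq hab hε.le hP, bellmanCandidate_of_eq_sq hδ0.le hpos hP]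
  · rw [bellmanCandidate_of_eq_top hQ]
    exact upperDyadicBellman_top_ge hab hε.le htop hQ

theorem lowerDyadicBellman_eq {a b ε δ : ℝ} (hab : a < b) (hε : 0 < ε) (hδ : ε < δ)
    (heq : DeltaMinusEq ε δ) {x : ℝ × ℝ} (hx : x ∈ bellmanDomain ε) :
    lowerDyadicBellman a b ε x = ENNReal.ofReal (Bminus δ x) := by
  rw [deltaMinusEq_iff] at heq
  rw [Bminus_eq_bellmanCandidate]
  have hδ0 : 0 < δ := hε.trans hδ
  have hprof : ∀ ρ, 0 ≤ ρ → 0 < bellmanProfile (-1) ρ := fun ρ hρ =>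
    mul_pos (by linarith) (Real.exp_pos _)
  have hpos := hprof δ hδ0.le
  have hposs := hprof _ (Real.sqrt_nonneg (δ ^ 2 - ε ^ 2))
  refine le_antisymm ?_
    (le_iInf₂ fun φ hφ => bellmanCandidate_le_expAverage hab hε hδ hpos heq hφ)
  have hgap : 0 < 2 - Real.exp (-(ε / √2)) := by
    have : Real.exp (-(ε / √2)) < 1 := by
      rw [Real.exp_lt_one_iff]; linarith [show 0 < ε / √2 by positivity]
    linarith
  have htop : lowerDyadicBellman a b ε (0, ε ^ 2) ≤
      ENNReal.ofReal (bellmanProfile (-1) √(δ ^ 2 - ε ^ 2) / bellmanProfile (-1) δ) := by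
    have hne : lowerDyadicBellman a b ε (0, ε ^ 2) ≠ ⊤ :=
      ne_top_of_le_ne_top ENNReal.ofReal_ne_top
        (lowerDyadicBellman_le_ofReal_exp hab hε.le (mem_bellmanDomain_of_eq_top (by simp)))
    have h := lowerDyadicBellman_top_self_improve hab hε.le
    lift lowerDyadicBellman a b ε (0, ε ^ 2) to NNReal using hne with c
    have hreal : 2 * c ≤ Real.exp (-(ε / √2)) * c + Real.exp (ε / √2) := by
      have := ENNReal.toReal_mono (by finiteness) h
      rwa [ENNReal.toReal_add (by finiteness) (by finiteness), ENNReal.toReal_mul,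
        ENNReal.toReal_mul, ENNReal.toReal_ofReal (Real.exp_pos _).le,
        ENNReal.toReal_ofReal (Real.exp_pos _).le] at this
    rw [← ENNReal.ofReal_coe_nnreal]
    refine ENNReal.ofReal_le_ofReal ?_
    rw [le_div_iff₀ hpos]
    rw [neg_one_mul, neg_neg] at heq
    refine le_of_mul_le_mul_right ?_ hgap
    rw [heq]
    nlinarith
  obtain ⟨P, Q, τ, hτ, hP, hQ, hseg, hxs, hval⟩ :=
    exists_bellmanCandidate_eq_chord (κ := -1) (by norm_num) hε hδ hx
  rw [hval]
  conv_lhs => rw [hxs]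
  have hP' := bellmanCandidate_of_eq_sq hδ0.le hpos hP
  refine lowerDyadicBellman_le_ofReal_chord hab hε.le hseg ?_ ?_ ?_ ?_ hτ
  · rw [hP']; positivity
  · rw [bellmanCandidate_of_eq_top hQ]; positivity
  · rw [lowerDyadicBellman_of_eq_sq hab hε.le hP, hP']
  · rw [bellmanCandidate_of_eq_top hQ, ENNReal.ofReal_mul (Real.exp_pos _).le]
    have h1 := lowerDyadicBellman_le_ofReal_exp_mul hab hε.le Q.1 (0, ε ^ 2)
    rw [show ((0, ε ^ 2) : ℝ × ℝ).1 + Q.1 = Q.1 by simp, show ((0, ε ^ 2) : ℝ × ℝ).2 +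
      2 * Q.1 * ((0, ε ^ 2) : ℝ × ℝ).1 + Q.1 ^ 2 = Q.2 by simp only; linarith] at h1
    exact h1.trans (mul_le_mul_right htop _)

/-! ### The degenerate case and the theorem -/

theorem eq_sq_of_mem_bellmanDomain_zero {x : ℝ × ℝ} (hx : x ∈ bellmanDomain 0) :
    x.2 = x.1 ^ 2 :=
  le_antisymm (by simpa using hx.2) hx.1

theorem mainTheorem4 (a b : ℝ) (hab : a < b) :
    -- the upper function, `0 < ε < √2 log 2`
    (∀ ε : ℝ, 0 < ε → ε < √2 * Real.log 2 →
      ∃ δ : ℝ, ε < δ ∧ δ < 1 ∧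
        (∀ δ' : ℝ, ε ≤ δ' → (DeltaPlusEq ε δ' ↔ δ' = δ)) ∧
        ∀ x ∈ bellmanDomain ε, upperDyadicBellman a b ε x = ENNReal.ofReal (Bplus δ x)) ∧
    -- the upper function, `ε = 0`, where the equation is an identity
    ((∀ δ : ℝ, 0 ≤ δ → DeltaPlusEq 0 δ) ∧
      ∀ δ : ℝ, 0 ≤ δ → δ < 1 →
        ∀ x ∈ bellmanDomain 0, upperDyadicBellman a b 0 x = ENNReal.ofReal (Bplus δ x)) ∧
    -- the upper function, `ε ≥ √2 log 2`
    (∀ ε : ℝ, √2 * Real.log 2 ≤ ε → ∀ x ∈ bellmanDomain ε,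
      (x.2 = x.1 ^ 2 → upperDyadicBellman a b ε x = ENNReal.ofReal (Real.exp x.1)) ∧
      (x.1 ^ 2 < x.2 → upperDyadicBellman a b ε x = ⊤)) ∧
    -- the lower function, `ε > 0`
    (∀ ε : ℝ, 0 < ε →
      ∃ δ : ℝ, ε < δ ∧
        (∀ δ' : ℝ, ε ≤ δ' → (DeltaMinusEq ε δ' ↔ δ' = δ)) ∧
        ∀ x ∈ bellmanDomain ε, lowerDyadicBellman a b ε x = ENNReal.ofReal (Bminus δ x)) ∧
    -- the lower function, `ε = 0`, where the equation is an identity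
    ((∀ δ : ℝ, 0 ≤ δ → DeltaMinusEq 0 δ) ∧
      ∀ δ : ℝ, 0 ≤ δ →
        ∀ x ∈ bellmanDomain 0, lowerDyadicBellman a b 0 x = ENNReal.ofReal (Bminus δ x)) := by
  refine ⟨fun ε hε hε' => ?_, ⟨fun δ => deltaPlusEq_zero, fun δ hδ hδ1 x hx => ?_⟩,
    fun ε hε x hx => ⟨fun h => ?_, upperDyadicBellman_eq_top hab hε hx⟩, fun ε hε => ?_,
    ⟨fun δ => deltaMinusEq_zero, fun δ hδ x hx => ?_⟩⟩
  · obtain ⟨δ, hδ, hδ1, huniq⟩ := exists_deltaPlus hε hε'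
    exact ⟨δ, hδ, hδ1, huniq, fun x hx =>
      upperDyadicBellman_eq hab hε hδ hδ1 ((huniq δ hδ.le).2 rfl) hx⟩
  · have h := eq_sq_of_mem_bellmanDomain_zero hx
    rw [upperDyadicBellman_of_eq_sq hab le_rfl h, Bplus_eq_bellmanCandidate,
      bellmanCandidate_of_eq_sq hδ (mul_pos (by linarith) (Real.exp_pos _)) h]
  · exact upperDyadicBellman_of_eq_sq hab (le_trans
      (mul_nonneg (Real.sqrt_nonneg _) (Real.log_nonneg (by norm_num))) hε) h
  · obtain ⟨δ, hδ, huniq⟩ := exists_deltaMinus hε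
    exact ⟨δ, hδ, huniq, fun x hx =>
      lowerDyadicBellman_eq hab hε hδ ((huniq δ hδ.le).2 rfl) hx⟩
  · have h := eq_sq_of_mem_bellmanDomain_zero hx
    rw [lowerDyadicBellman_of_eq_sq hab le_rfl h, Bminus_eq_bellmanCandidate,
      bellmanCandidate_of_eq_sq hδ (mul_pos (by linarith) (Real.exp_pos _)) h]
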